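/- **Completeness of normalization by evaluation for 2-layered contextual modal type theory.** *System.* Core types are $\mathsf{Nat}$ and $S\to T$ for core $S,T$. Types are $\mathsf{Nat}$, $S\to T$, and contextual types $[\Delta\vdash T]$ with $\Delta$ a context of core types and $T$ a core type. Global contexts $\Psi$ list declarations $u:(\Delta\vdash T)$ with $\Delta,T$ core. Local contexts $\Gamma$ consist of core types at layer $0$ and of types at layer $1$. At both layers $i$ the terms of $\Psi;\Gamma\vdash_i t:T$ are local variables $x$, global variables $u^\delta$ with $u:(\Delta\vdash T)\in\Psi$ and a local substitution $\Psi;\Gamma\vdash_i\delta:\Delta$, $\mathsf{zero}$, $\mathsf{succ}\,t$, $\lambda x.t$ and $t\,s$. At layer $1$ there are in addition - $\mathsf{box}\,t:[\Delta\vdash T]$ for $\Psi;\Delta\vdash_0 t:T$; - $\mathsf{letbox}\ u\leftarrow s\ \mathsf{in}\ t:T'$ for $s:[\Delta\vdash T]$ and $\Psi,u:(\Delta\vdash T);\Gamma\vdash_1 t:T'$; - $\mathsf{match}\ s\ \vec b:T'$ for $s:[\Delta\vdash T]$, where $\vec b$ has exactly one branch for each pattern compatible with $T$: $x$ for each $x:T$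 in $\Delta$; $\mathsf{zero}$ and $\mathsf{succ}\,?u$ if $T=\mathsf{Nat}$, with $u:(\Delta\vdash\mathsf{Nat})$; $\lambda x.?u$ if $T=S\to T_0$, with $u:(\Delta,x:S\vdash T_0)$; and $?u\;?u'$, whose body must be typed with $u:(\Delta\vdash S\to T)$ and $u':(\Delta\vdash S)$ for every core type $S$. The order of the branches is immaterial. Terms are considered together with their typing derivations; in particular the body of an application branch is a family of derivations indexed by the core types $S$. *Equivalence.* $\Psi;\Gamma\vdash_0 t\approx t':T$ is generated by symmetry, transitivity and congruence. $\Psi;\Gamma\vdash_1 t\approx t':T$ is generated by symmetry, transitivity, congruence (with $\mathsf{box}\,t\approx\mathsf{box}\,t'$ when $t\approx t'$ at layer $0$), the rules $(\lambda x.t)\,s\approx t[s/x]$ and $\mathsf{letbox}\ u\leftarrow\mathsf{box}\,s\ \mathsf{in}\ t\approx t[s/u]$, the rules that reduce $\mathsf{match}\ (\mathsf{box}\,c)\ \vec b$, for $c$ one of $x$, $\mathsf{zero}$, $\mathsf{succ}\,s$, $\lambda x.s$, $t\,s$, to the body of the corresponding branch with the immediate subterms of $c$ substituted for the pattern variables (for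 $c=t\,s$ with $s:S$, the body at $S$), and $t\approx\lambda x.(t\,x)$ at function types. *Normal and neutral forms.* Normal forms are $w ::= v\mid\mathsf{zero}\mid\mathsf{succ}\,w\mid\mathsf{box}\,t\mid\lambda x.w$ with $t$ any layer-$0$ term, and neutral forms are $v ::= x\mid u^\theta\mid v\,w\mid\mathsf{letbox}\ u\leftarrow v\ \mathsf{in}\ w\mid\mathsf{match}\ v\ \vec r\mid\mathsf{match}\ (\mathsf{box}\,u^\delta)\ \vec r$, typed at layer $1$, where $\theta$ consists of normal forms and $\vec r$ of branches with normal bodies. *The algorithm.* Objects are dual contexts $\Psi;\Gamma$ and morphisms are pairs of order-preserving weakenings $\gamma;\tau:\Psi';\Gamma'\Rightarrow\Psi;\Gamma$. Types are interpreted by letting $[\![\mathsf{Nat}]\!]$ and $[\![[\Delta\vdash T]]\!]$ be the sets of normal forms of that type, and by $[\![S\to T]\!]_{\Psi;\Gamma}:=\forall\,(\Psi';\Gamma'\Rightarrow\Psi;\Gamma).\ [\![S]\!]_{\Psi';\Gamma'}\to[\![T]\!]_{\Psi';\Gamma'}$. Contexts are interpreted by $[\![\cdot]\!]:=\{*\}$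 and $[\![\Delta,x:T]\!]:=[\![\Delta]\!]\times[\![T]\!]$. Reification $\downarrow^T$ into normal forms and reflection $\uparrow^T$ from neutral forms are identities (inclusions) except that $\downarrow^{S\to T}(a):=\lambda x.\downarrow^T(a(\mathrm{id};p(\mathrm{id}),\uparrow^S x))$ and $\uparrow^{S\to T}(v)(\gamma;\tau,a):=\uparrow^T(v[\gamma;\tau]\ \downarrow^S(a))$. For $\Phi;\Delta\vdash_0 t:T$, a weakening $\gamma:\Psi\Rightarrow\Phi$ and $\rho\in[\![\Delta]\!]_{\Psi;\Gamma}$, and for $\Phi;\Delta\vdash_1 t:T$, a global substitution $\Psi\vdash\sigma:\Phi$ (by layer-$0$ terms) and $\rho\in[\![\Delta]\!]_{\Psi;\Gamma}$, the interpretations $[\![t]\!]^0(\gamma;\rho)$ and $[\![t]\!]^1(\sigma;\rho)$ in $[\![T]\!]_{\Psi;\Gamma}$ are the usual ones on $x$, $\mathsf{zero}$, $\mathsf{succ}$, $\lambda$ and application, and otherwise: - $[\![u^\delta]\!]^0(\gamma;\rho):=\uparrow(u[\gamma]^\theta)$, where $\theta$ is the componentwise reification of $[\![\delta]\!]^0(\gamma;\rho)$;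 - $[\![u^\delta]\!]^1(\sigma;\rho):=[\![\sigma(u)]\!]^0(\mathrm{id};[\![\delta]\!]^1(\sigma;\rho))$ and $[\![\mathsf{box}\,t]\!]^1(\sigma;\rho):=\mathsf{box}(t[\sigma])$; - $[\![\mathsf{letbox}\ u\leftarrow s\ \mathsf{in}\ t]\!]^1(\sigma;\rho)$ is $[\![t]\!]^1(\sigma,c/u;\rho)$ if $[\![s]\!]^1(\sigma;\rho)=\mathsf{box}\,c$, and $\uparrow(\mathsf{letbox}\ u\leftarrow v\ \mathsf{in}\downarrow[\![t]\!]^1(\sigma[p(\mathrm{id})],u/u;\rho[p(\mathrm{id});\mathrm{id}]))$ if it is a neutral $v$; - $[\![\mathsf{match}\ s\ \vec b]\!]^1(\sigma;\rho)$: if $[\![s]\!]^1(\sigma;\rho)=\mathsf{box}\,c$ and $c$ is not a global variable, it is the interpretation of the body of the branch selected by $c$, with $\sigma$ extended by the immediate subterms of $c$; if the value is $\mathsf{box}\,u^\delta$ or a neutral $v$, it is $\uparrow(\mathsf{match}\ (\mathsf{box}\,u^\delta)\ \vec r)$ or $\uparrow(\mathsf{match}\ v\ \vec r)$, where $\vec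 r$ is obtained from $\vec b$ by interpreting and reifying each body in $(\sigma;\rho)$ weakened by the pattern variables of the branch and extended by the identity on them (for $?u\;?u'$, at each core type $S$). Finally $\mathsf{nbe}^T_{\Psi;\Gamma}(t):=\downarrow^T([\![t]\!]^1(\mathrm{id};\uparrow^\Gamma))$, where $\uparrow^\Gamma$ is the environment of reflected variables. *Theorem.* If $\Psi;\Gamma\vdash_1 t\approx t':T$, then $\mathsf{nbe}^T_{\Psi;\Gamma}(t)=\mathsf{nbe}^T_{\Psi;\Gamma}(t')$. -/

import Mathlib

namespace Layered

/-! ## Types, contexts, variables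

Types are well formed by construction. `CTy` is the set of core types (those that contain no
contextual type), and `Ty` is the set of types in which every contextual type `[Δ ⊢ T]` has a core
context `Δ` and a core type `T`. Contexts are lists with the newest binding first, and variables
are typed de Bruijn indices. -/

/-- Core types. -/
inductive CTy : Type
  | nat : CTy
  | arr : CTy → CTy → CTy

/-- Core local contexts. -/
abbrev CCtx : Type := List CTy

/-- Types of layer 1; `box Δ T` is the contextual type of code of type `T` open over `Δ`. -/
inductive Ty : Type
  | nat : Ty
  | arr : Ty → Ty → Ty
  | box : CCtx → CTy → Ty

/-- Every core type is a type. -/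
def CTy.toTy : CTy → Ty
  | .nat => .nat
  | .arr S T => .arr S.toTy T.toTy

/-- Local contexts of layer 1. -/
abbrev Ctx : Type := List Ty

/-- The declaration `u : (ctx ⊢ ty)` of a global variable. -/
structure GDecl : Type where
  ctx : CCtx
  ty : CTy

/-- Global contexts. -/
abbrev GCtx : Type := List GDecl

/-- `Var Γ a` is the set of variables of type `a` in the context `Γ`. -/
inductive Var {α : Type} : List α → α → Type
  | z {Γ : List α} {a : α} : Var (a :: Γ) a
  | s {Γ : List α} {a b : α} : Var Γ a → Var (b :: Γ) a

/-- `Pat Δ T`: the patterns against which code of type `T` in the context `Δ` is matched.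
There is one application pattern for each core type `S` of the argument. -/
inductive Pat (Δ : CCtx) : CTy → Type
  | var {T : CTy} : Var Δ T → Pat Δ T
  | zero : Pat Δ .nat
  | succ : Pat Δ .nat
  | lam {S T : CTy} : Pat Δ (.arr S T)
  | app {T : CTy} (S : CTy) : Pat Δ T

/-- The global variables bound by a pattern, newest first: `?u` in `succ ?u` and in `λ x. ?u`,
and `?u`, `?u'` in `?u ?u'`. -/
def Pat.binds {Δ : CCtx} : {T : CTy} → Pat Δ T → GCtx
  | _, .var _ => []
  | _, .zero => []
  | _, .succ => [⟨Δ, .nat⟩]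
  | _, .lam (S := S) (T := T) => [⟨S :: Δ, T⟩]
  | _, .app (T := T) S => [⟨Δ, S⟩, ⟨Δ, .arr S T⟩]

/-! ## Terms

Terms are taken together with their typing derivations. A local substitution for `Δ` is the family
of its components, indexed by the variables of `Δ`. -/

/-- `Exp0 Ψ Γ T`: derivations `Ψ; Γ ⊢₀ t : T`, the code. -/
inductive Exp0 (Ψ : GCtx) : CCtx → CTy → Type
  | var {Γ : CCtx} {T : CTy} : Var Γ T → Exp0 Ψ Γ T
  | gvar {Γ Δ : CCtx} {T : CTy} (u : Var Ψ ⟨Δ, T⟩)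
      (δ : ∀ A : CTy, Var Δ A → Exp0 Ψ Γ A) : Exp0 Ψ Γ T
  | zero {Γ : CCtx} : Exp0 Ψ Γ .nat
  | succ {Γ : CCtx} : Exp0 Ψ Γ .nat → Exp0 Ψ Γ .nat
  | lam {Γ : CCtx} {S T : CTy} : Exp0 Ψ (S :: Γ) T → Exp0 Ψ Γ (.arr S T)
  | app {Γ : CCtx} {S T : CTy} : Exp0 Ψ Γ (.arr S T) → Exp0 Ψ Γ S → Exp0 Ψ Γ T

/-- `Exp1 Ψ Γ T`: derivations `Ψ; Γ ⊢₁ t : T`. In `matchc s b` the covering list of branches `b`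
is given by its lookup function on patterns; the derivation of the application branch
is a family, over all core types `S`, of derivations for its body. -/
inductive Exp1 : GCtx → Ctx → Ty → Type
  | var {Ψ : GCtx} {Γ : Ctx} {T : Ty} : Var Γ T → Exp1 Ψ Γ T
  | gvar {Ψ : GCtx} {Γ : Ctx} {Δ : CCtx} {T : CTy} (u : Var Ψ ⟨Δ, T⟩)
      (δ : ∀ A : CTy, Var Δ A → Exp1 Ψ Γ A.toTy) : Exp1 Ψ Γ T.toTy
  | zero {Ψ : GCtx} {Γ : Ctx} : Exp1 Ψ Γ .nat
  | succ {Ψ : GCtx} {Γ : Ctx} : Exp1 Ψ Γ .nat → Exp1 Ψ Γ .nat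
  | lam {Ψ : GCtx} {Γ : Ctx} {S T : Ty} : Exp1 Ψ (S :: Γ) T → Exp1 Ψ Γ (.arr S T)
  | app {Ψ : GCtx} {Γ : Ctx} {S T : Ty} : Exp1 Ψ Γ (.arr S T) → Exp1 Ψ Γ S → Exp1 Ψ Γ T
  | box {Ψ : GCtx} {Γ : Ctx} {Δ : CCtx} {T : CTy} : Exp0 Ψ Δ T → Exp1 Ψ Γ (.box Δ T)
  | letbox {Ψ : GCtx} {Γ : Ctx} {Δ : CCtx} {T : CTy} {T' : Ty} :
      Exp1 Ψ Γ (.box Δ T) → Exp1 (⟨Δ, T⟩ :: Ψ) Γ T' → Exp1 Ψ Γ T'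
  | matchc {Ψ : GCtx} {Γ : Ctx} {Δ : CCtx} {T : CTy} {T' : Ty} :
      Exp1 Ψ Γ (.box Δ T) → (∀ p : Pat Δ T, Exp1 (p.binds ++ Ψ) Γ T') → Exp1 Ψ Γ T'

/-! ## Weakenings -/

/-- `Wk Γ Δ`: weakenings from `Γ` to `Δ`, used for global and for local contexts. The
constructors are `ε`, `q` and `p`. -/
inductive Wk {α : Type} : List α → List α → Type
  | nil : Wk [] []
  | keep {Γ Δ : List α} (a : α) : Wk Γ Δ → Wk (a :: Γ) (a :: Δ)
  | drop {Γ Δ : List α} (a : α) : Wk Γ Δ → Wk (a :: Γ) Δ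

namespace Wk

variable {α : Type}

/-- The identity weakening. -/
def id : (Γ : List α) → Wk Γ Γ
  | [] => .nil
  | a :: Γ => .keep a (id Γ)

/-- `comp τ τ'` is the composite `τ ∘ τ'`. -/
def comp : {Γ₂ Γ₁ Γ₀ : List α} → Wk Γ₁ Γ₂ → Wk Γ₀ Γ₁ → Wk Γ₀ Γ₂
  | _, _, _, τ, .nil => τ
  | _, _, _, .keep a τ, .keep _ τ' => .keep a (comp τ τ')
  | _, _, _, .drop a τ, .keep _ τ' => .drop a (comp τ τ')
  | _, _, _, τ, .drop a τ' => .drop a (comp τ τ')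

/-- The action of a weakening on variables. -/
def var : {Γ Δ : List α} → Wk Γ Δ → {a : α} → Var Δ a → Var Γ a
  | _, _, .keep _ _, _, .z => .z
  | _, _, .keep _ τ, _, .s x => .s (τ.var x)
  | _, _, .drop _ τ, _, x => .s (τ.var x)

/-- `q` applied once for each entry of `Ξ`. -/
def keeps {Γ Δ : List α} (τ : Wk Γ Δ) : (Ξ : List α) → Wk (Ξ ++ Γ) (Ξ ++ Δ)
  | [] => τ
  | a :: Ξ => .keep a (keeps τ Ξ)

/-- `p` applied once for each entry of `Ξ`, to the identity. -/
def drops (Γ : List α) : (Ξ : List α) → Wk (Ξ ++ Γ) Γ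
  | [] => id Γ
  | a :: Ξ => .drop a (drops Γ Ξ)

end Wk

/-- Weakening of code. -/
def Exp0.wk {Ψ Ψ' : GCtx} (γ : Wk Ψ' Ψ) : {Γ Γ' : CCtx} → {T : CTy} → Wk Γ' Γ →
    Exp0 Ψ Γ T → Exp0 Ψ' Γ' T
  | _, _, _, τ, .var x => .var (τ.var x)
  | _, _, _, τ, .gvar u δ => .gvar (γ.var u) (fun A x => (δ A x).wk γ τ)
  | _, _, _, _, .zero => .zero
  | _, _, _, τ, .succ t => .succ (t.wk γ τ)
  | _, _, _, τ, .lam t => .lam (t.wk γ (.keep _ τ))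
  | _, _, _, τ, .app t s => .app (t.wk γ τ) (s.wk γ τ)

/-- Weakening of terms of layer 1. -/
def Exp1.wk : {Ψ Ψ' : GCtx} → {Γ Γ' : Ctx} → {T : Ty} → Wk Ψ' Ψ → Wk Γ' Γ →
    Exp1 Ψ Γ T → Exp1 Ψ' Γ' T
  | _, _, _, _, _, _, τ, .var x => .var (τ.var x)
  | _, _, _, _, _, γ, τ, .gvar u δ => .gvar (γ.var u) (fun A x => (δ A x).wk γ τ)
  | _, _, _, _, _, _, _, .zero => .zero
  | _, _, _, _, _, γ, τ, .succ t => .succ (t.wk γ τ)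
  | _, _, _, _, _, γ, τ, .lam t => .lam (t.wk γ (.keep _ τ))
  | _, _, _, _, _, γ, τ, .app t s => .app (t.wk γ τ) (s.wk γ τ)
  | _, _, _, _, _, γ, _, .box t => .box (t.wk γ (Wk.id _))
  | _, _, _, _, _, γ, τ, .letbox s t => .letbox (s.wk γ τ) (t.wk (.keep _ γ) τ)
  | _, _, _, _, _, γ, τ, .matchc s b =>
      .matchc (s.wk γ τ) (fun p => (b p).wk (γ.keeps p.binds) τ)

/-! ## Substitutions -/

/-- Local substitutions of layer 0, `Ψ; Γ ⊢₀ δ : Δ`. -/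
abbrev Sub0 (Ψ : GCtx) (Γ Δ : CCtx) : Type := ∀ A : CTy, Var Δ A → Exp0 Ψ Γ A

/-- Local substitutions of layer 1, `Ψ; Γ ⊢₁ δ : Δ`, for a core context `Δ`. -/
abbrev SubC (Ψ : GCtx) (Γ : Ctx) (Δ : CCtx) : Type := ∀ A : CTy, Var Δ A → Exp1 Ψ Γ A.toTy

/-- Local substitutions of layer 1, `Ψ; Γ ⊢₁ δ : Δ`. -/
abbrev Sub1 (Ψ : GCtx) (Γ Δ : Ctx) : Type := ∀ A : Ty, Var Δ A → Exp1 Ψ Γ A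

/-- Global substitutions, `Ψ ⊢ σ : Φ`. -/
abbrev GSub (Ψ Φ : GCtx) : Type := ∀ (Δ : CCtx) (T : CTy), Var Φ ⟨Δ, T⟩ → Exp0 Ψ Δ T

/-- The identity local substitution of layer 0. -/
def Sub0.id (Ψ : GCtx) (Γ : CCtx) : Sub0 Ψ Γ Γ := fun _ x => .var x

/-- `δ, x/x` for a new variable `x`. -/
def Sub0.lift {Ψ : GCtx} {Γ Δ : CCtx} (S : CTy) (δ : Sub0 Ψ Γ Δ) : Sub0 Ψ (S :: Γ) (S :: Δ)
  | _, .z => .var .z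
  | _, .s x => (δ _ x).wk (Wk.id Ψ) (.drop S (Wk.id Γ))

/-- `δ, x/x` for a new variable `x`. -/
def SubC.lift {Ψ : GCtx} {Γ : Ctx} {Δ : CCtx} (S : CTy) (δ : SubC Ψ Γ Δ) :
    SubC Ψ (S.toTy :: Γ) (S :: Δ)
  | _, .z => .var .z
  | _, .s x => (δ _ x).wk (Wk.id Ψ) (.drop S.toTy (Wk.id Γ))

/-- The identity local substitution of layer 1. -/
def Sub1.id (Ψ : GCtx) (Γ : Ctx) : Sub1 Ψ Γ Γ := fun _ x => .var x

/-- `δ, t/x`. -/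
def Sub1.cons {Ψ : GCtx} {Γ Δ : Ctx} {S : Ty} (δ : Sub1 Ψ Γ Δ) (t : Exp1 Ψ Γ S) :
    Sub1 Ψ Γ (S :: Δ)
  | _, .z => t
  | _, .s x => δ _ x

/-- Weakening of local substitutions. -/
def Sub1.wk {Ψ Ψ' : GCtx} {Γ Γ' Δ : Ctx} (γ : Wk Ψ' Ψ) (τ : Wk Γ' Γ) (δ : Sub1 Ψ Γ Δ) :
    Sub1 Ψ' Γ' Δ := fun A x => (δ A x).wk γ τ

/-- `δ, x/x` for a new variable `x`. -/
def Sub1.lift {Ψ : GCtx} {Γ Δ : Ctx} (S : Ty) (δ : Sub1 Ψ Γ Δ) : Sub1 Ψ (S :: Γ) (S :: Δ) :=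
  Sub1.cons (Sub1.wk (Wk.id Ψ) (.drop S (Wk.id Γ)) δ) (.var .z)

/-- `t[δ]` at layer 0. -/
def Exp0.lsubst {Ψ : GCtx} : {Γ Δ : CCtx} → {T : CTy} → Sub0 Ψ Γ Δ → Exp0 Ψ Δ T → Exp0 Ψ Γ T
  | _, _, _, δ, .var x => δ _ x
  | _, _, _, δ, .gvar u δ' => .gvar u (fun A x => (δ' A x).lsubst δ)
  | _, _, _, _, .zero => .zero
  | _, _, _, δ, .succ t => .succ (t.lsubst δ)
  | _, _, _, δ, .lam t => .lam (t.lsubst (Sub0.lift _ δ))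
  | _, _, _, δ, .app t s => .app (t.lsubst δ) (s.lsubst δ)

/-- `t[δ]` for code `t` that is lifted to layer 1 and a substitution `δ` of layer 1. -/
def Exp0.run {Ψ : GCtx} : {Γ : Ctx} → {Δ : CCtx} → {T : CTy} → SubC Ψ Γ Δ → Exp0 Ψ Δ T →
    Exp1 Ψ Γ T.toTy
  | _, _, _, δ, .var x => δ _ x
  | _, _, _, δ, .gvar u δ' => .gvar u (fun A x => (δ' A x).run δ)
  | _, _, _, _, .zero => .zero
  | _, _, _, δ, .succ t => .succ (t.run δ)
  | _, _, _, δ, .lam t => .lam (t.run (SubC.lift _ δ))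
  | _, _, _, δ, .app t s => .app (t.run δ) (s.run δ)

/-- `t[δ]` at layer 1. -/
def Exp1.lsubst : {Ψ : GCtx} → {Γ Δ : Ctx} → {T : Ty} → Sub1 Ψ Γ Δ → Exp1 Ψ Δ T → Exp1 Ψ Γ T
  | _, _, _, _, δ, .var x => δ _ x
  | _, _, _, _, δ, .gvar u δ' => .gvar u (fun A x => (δ' A x).lsubst δ)
  | _, _, _, _, _, .zero => .zero
  | _, _, _, _, δ, .succ t => .succ (t.lsubst δ)
  | _, _, _, _, δ, .lam t => .lam (t.lsubst (Sub1.lift _ δ))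
  | _, _, _, _, δ, .app t s => .app (t.lsubst δ) (s.lsubst δ)
  | _, _, _, _, _, .box t => .box t
  | Ψ, _, _, _, δ, .letbox s t =>
      .letbox (s.lsubst δ) (t.lsubst (Sub1.wk (.drop _ (Wk.id Ψ)) (Wk.id _) δ))
  | Ψ, _, _, _, δ, .matchc s b =>
      .matchc (s.lsubst δ) (fun p => (b p).lsubst (Sub1.wk (Wk.drops Ψ p.binds) (Wk.id _) δ))

/-- The identity global substitution, `u ↦ u^id`. -/
def GSub.id (Ψ : GCtx) : GSub Ψ Ψ := fun Δ _ u => .gvar u (Sub0.id Ψ Δ)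

/-- `σ, t/u`. -/
def GSub.cons {Ψ Φ : GCtx} {Δ : CCtx} {T : CTy} (σ : GSub Ψ Φ) (t : Exp0 Ψ Δ T) :
    GSub Ψ (⟨Δ, T⟩ :: Φ)
  | _, _, .z => t
  | _, _, .s u => σ _ _ u

/-- `σ[γ]`. -/
def GSub.wk {Ψ Ψ' Φ : GCtx} (γ : Wk Ψ' Ψ) (σ : GSub Ψ Φ) : GSub Ψ' Φ :=
  fun Δ T u => (σ Δ T u).wk γ (Wk.id Δ)

/-- `σ[p(id)], u/u` for a new variable `u`. -/
def GSub.lift {Ψ Φ : GCtx} (d : GDecl) (σ : GSub Ψ Φ) : GSub (d :: Ψ) (d :: Φ) :=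
  GSub.cons (σ.wk (.drop d (Wk.id Ψ))) (.gvar .z (Sub0.id _ _))

/-- `GSub.lift`, once for each entry of `Ξ`. -/
def GSub.lifts {Ψ Φ : GCtx} (σ : GSub Ψ Φ) : (Ξ : GCtx) → GSub (Ξ ++ Ψ) (Ξ ++ Φ)
  | [] => σ
  | d :: Ξ => GSub.lift d (GSub.lifts σ Ξ)

/-- `t[σ]` at layer 0. -/
def Exp0.gsubst {Ψ Φ : GCtx} (σ : GSub Ψ Φ) : {Γ : CCtx} → {T : CTy} → Exp0 Φ Γ T → Exp0 Ψ Γ T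
  | _, _, .var x => .var x
  | _, _, .gvar u δ => (σ _ _ u).lsubst (fun A x => (δ A x).gsubst σ)
  | _, _, .zero => .zero
  | _, _, .succ t => .succ (t.gsubst σ)
  | _, _, .lam t => .lam (t.gsubst σ)
  | _, _, .app t s => .app (t.gsubst σ) (s.gsubst σ)

/-- `t[σ]` at layer 1. -/
def Exp1.gsubst : {Ψ Φ : GCtx} → {Γ : Ctx} → {T : Ty} → GSub Ψ Φ → Exp1 Φ Γ T → Exp1 Ψ Γ T
  | _, _, _, _, _, .var x => .var x
  | _, _, _, _, σ, .gvar u δ => (σ _ _ u).run (fun A x => (δ A x).gsubst σ)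
  | _, _, _, _, _, .zero => .zero
  | _, _, _, _, σ, .succ t => .succ (t.gsubst σ)
  | _, _, _, _, σ, .lam t => .lam (t.gsubst σ)
  | _, _, _, _, σ, .app t s => .app (t.gsubst σ) (s.gsubst σ)
  | _, _, _, _, σ, .box t => .box (t.gsubst σ)
  | _, _, _, _, σ, .letbox s t => .letbox (s.gsubst σ) (t.gsubst (GSub.lift _ σ))
  | _, _, _, _, σ, .matchc s b =>
      .matchc (s.gsubst σ) (fun p => (b p).gsubst (GSub.lifts σ p.binds))

/-! ## Equivalence -/

/-- `Ψ; Γ ⊢₀ t ≈ t' : T`. -/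
inductive Eqv0 {Ψ : GCtx} : {Γ : CCtx} → {T : CTy} → Exp0 Ψ Γ T → Exp0 Ψ Γ T → Prop
  | symm {Γ : CCtx} {T : CTy} {s t : Exp0 Ψ Γ T} : Eqv0 s t → Eqv0 t s
  | trans {Γ : CCtx} {T : CTy} {s t r : Exp0 Ψ Γ T} : Eqv0 s t → Eqv0 t r → Eqv0 s r
  | var {Γ : CCtx} {T : CTy} (x : Var Γ T) : Eqv0 (.var x) (.var x)
  | gvar {Γ Δ : CCtx} {T : CTy} (u : Var Ψ ⟨Δ, T⟩) {δ δ' : Sub0 Ψ Γ Δ} :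
      (∀ (A : CTy) (x : Var Δ A), Eqv0 (δ A x) (δ' A x)) → Eqv0 (.gvar u δ) (.gvar u δ')
  | zero {Γ : CCtx} : Eqv0 (Exp0.zero (Γ := Γ)) .zero
  | succ {Γ : CCtx} {t t' : Exp0 Ψ Γ .nat} : Eqv0 t t' → Eqv0 (.succ t) (.succ t')
  | lam {Γ : CCtx} {S T : CTy} {t t' : Exp0 Ψ (S :: Γ) T} : Eqv0 t t' → Eqv0 (.lam t) (.lam t')
  | app {Γ : CCtx} {S T : CTy} {t t' : Exp0 Ψ Γ (.arr S T)} {s s' : Exp0 Ψ Γ S} :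
      Eqv0 t t' → Eqv0 s s' → Eqv0 (.app t s) (.app t' s')

/-- `Ψ; Γ ⊢₁ t ≈ t' : T`: partial equivalence rules, congruence rules, `β` rules and the `η` rule
for functions. -/
inductive Eqv1 : {Ψ : GCtx} → {Γ : Ctx} → {T : Ty} → Exp1 Ψ Γ T → Exp1 Ψ Γ T → Prop
  | symm {Ψ : GCtx} {Γ : Ctx} {T : Ty} {s t : Exp1 Ψ Γ T} : Eqv1 s t → Eqv1 t s
  | trans {Ψ : GCtx} {Γ : Ctx} {T : Ty} {s t r : Exp1 Ψ Γ T} : Eqv1 s t → Eqv1 t r → Eqv1 s r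
  | var {Ψ : GCtx} {Γ : Ctx} {T : Ty} (x : Var Γ T) : Eqv1 (Exp1.var (Ψ := Ψ) x) (.var x)
  | gvar {Ψ : GCtx} {Γ : Ctx} {Δ : CCtx} {T : CTy} (u : Var Ψ ⟨Δ, T⟩) {δ δ' : SubC Ψ Γ Δ} :
      (∀ (A : CTy) (x : Var Δ A), Eqv1 (δ A x) (δ' A x)) → Eqv1 (.gvar u δ) (.gvar u δ')
  | zero {Ψ : GCtx} {Γ : Ctx} : Eqv1 (Exp1.zero (Ψ := Ψ) (Γ := Γ)) .zero
  | succ {Ψ : GCtx} {Γ : Ctx} {t t' : Exp1 Ψ Γ .nat} : Eqv1 t t' → Eqv1 (.succ t) (.succ t')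
  | lam {Ψ : GCtx} {Γ : Ctx} {S T : Ty} {t t' : Exp1 Ψ (S :: Γ) T} :
      Eqv1 t t' → Eqv1 (.lam t) (.lam t')
  | app {Ψ : GCtx} {Γ : Ctx} {S T : Ty} {t t' : Exp1 Ψ Γ (.arr S T)} {s s' : Exp1 Ψ Γ S} :
      Eqv1 t t' → Eqv1 s s' → Eqv1 (.app t s) (.app t' s')
  | box {Ψ : GCtx} {Γ : Ctx} {Δ : CCtx} {T : CTy} {t t' : Exp0 Ψ Δ T} :
      Eqv0 t t' → Eqv1 (Exp1.box (Γ := Γ) t) (.box t')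
  | letbox {Ψ : GCtx} {Γ : Ctx} {Δ : CCtx} {T : CTy} {T' : Ty} {s s' : Exp1 Ψ Γ (.box Δ T)}
      {t t' : Exp1 (⟨Δ, T⟩ :: Ψ) Γ T'} :
      Eqv1 s s' → Eqv1 t t' → Eqv1 (.letbox s t) (.letbox s' t')
  | matchc {Ψ : GCtx} {Γ : Ctx} {Δ : CCtx} {T : CTy} {T' : Ty} {s s' : Exp1 Ψ Γ (.box Δ T)}
      {b b' : ∀ p : Pat Δ T, Exp1 (p.binds ++ Ψ) Γ T'} :
      Eqv1 s s' → (∀ p : Pat Δ T, Eqv1 (b p) (b' p)) → Eqv1 (.matchc s b) (.matchc s' b')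
  | beta_lam {Ψ : GCtx} {Γ : Ctx} {S T : Ty} (t : Exp1 Ψ (S :: Γ) T) (s : Exp1 Ψ Γ S) :
      Eqv1 (.app (.lam t) s) (t.lsubst (Sub1.cons (Sub1.id Ψ Γ) s))
  | beta_letbox {Ψ : GCtx} {Γ : Ctx} {Δ : CCtx} {T : CTy} {T' : Ty} (s : Exp0 Ψ Δ T)
      (t : Exp1 (⟨Δ, T⟩ :: Ψ) Γ T') :
      Eqv1 (.letbox (.box s) t) (t.gsubst (GSub.cons (GSub.id Ψ) s))
  | beta_match_var {Ψ : GCtx} {Γ : Ctx} {Δ : CCtx} {T : CTy} {T' : Ty} (x : Var Δ T)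
      (b : ∀ p : Pat Δ T, Exp1 (p.binds ++ Ψ) Γ T') :
      Eqv1 (.matchc (.box (.var x)) b) (b (.var x))
  | beta_match_zero {Ψ : GCtx} {Γ : Ctx} {Δ : CCtx} {T' : Ty}
      (b : ∀ p : Pat Δ .nat, Exp1 (p.binds ++ Ψ) Γ T') :
      Eqv1 (.matchc (.box .zero) b) (b .zero)
  | beta_match_succ {Ψ : GCtx} {Γ : Ctx} {Δ : CCtx} {T' : Ty} (s : Exp0 Ψ Δ .nat)
      (b : ∀ p : Pat Δ .nat, Exp1 (p.binds ++ Ψ) Γ T') :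
      Eqv1 (.matchc (.box (.succ s)) b) ((b .succ).gsubst (GSub.cons (GSub.id Ψ) s))
  | beta_match_lam {Ψ : GCtx} {Γ : Ctx} {Δ : CCtx} {S T : CTy} {T' : Ty} (s : Exp0 Ψ (S :: Δ) T)
      (b : ∀ p : Pat Δ (.arr S T), Exp1 (p.binds ++ Ψ) Γ T') :
      Eqv1 (.matchc (.box (.lam s)) b) ((b .lam).gsubst (GSub.cons (GSub.id Ψ) s))
  | beta_match_app {Ψ : GCtx} {Γ : Ctx} {Δ : CCtx} {S T : CTy} {T' : Ty}
      (t : Exp0 Ψ Δ (.arr S T)) (s : Exp0 Ψ Δ S)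
      (b : ∀ p : Pat Δ T, Exp1 (p.binds ++ Ψ) Γ T') :
      Eqv1 (.matchc (.box (.app t s)) b)
        ((b (.app S)).gsubst (GSub.cons (GSub.cons (GSub.id Ψ) t) s))
  | eta {Ψ : GCtx} {Γ : Ctx} {S T : Ty} (t : Exp1 Ψ Γ (.arr S T)) :
      Eqv1 t (.lam (.app (t.wk (Wk.id Ψ) (.drop S (Wk.id Γ))) (.var .z)))

/-! ## Normal and neutral forms -/

mutual

/-- Neutral forms of type `T`. -/
inductive Ne : GCtx → Ctx → Ty → Type
  | var {Ψ : GCtx} {Γ : Ctx} {T : Ty} : Var Γ T → Ne Ψ Γ T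
  | gvar {Ψ : GCtx} {Γ : Ctx} {Δ : CCtx} {T : CTy} (u : Var Ψ ⟨Δ, T⟩)
      (θ : ∀ A : CTy, Var Δ A → Nf Ψ Γ A.toTy) : Ne Ψ Γ T.toTy
  | app {Ψ : GCtx} {Γ : Ctx} {S T : Ty} : Ne Ψ Γ (.arr S T) → Nf Ψ Γ S → Ne Ψ Γ T
  | letbox {Ψ : GCtx} {Γ : Ctx} {Δ : CCtx} {T : CTy} {T' : Ty} :
      Ne Ψ Γ (.box Δ T) → Nf (⟨Δ, T⟩ :: Ψ) Γ T' → Ne Ψ Γ T'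
  /-- `match v r` for neutral `v`. -/
  | matchNe {Ψ : GCtx} {Γ : Ctx} {Δ : CCtx} {T : CTy} {T' : Ty} :
      Ne Ψ Γ (.box Δ T) → (∀ p : Pat Δ T, Nf (p.binds ++ Ψ) Γ T') → Ne Ψ Γ T'
  /-- `match (box u^δ) r`. -/
  | matchGvar {Ψ : GCtx} {Γ : Ctx} {Δ Δ' : CCtx} {T : CTy} {T' : Ty} (u : Var Ψ ⟨Δ', T⟩)
      (δ : Sub0 Ψ Δ Δ') : (∀ p : Pat Δ T, Nf (p.binds ++ Ψ) Γ T') → Ne Ψ Γ T'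

/-- Normal forms of type `T`. -/
inductive Nf : GCtx → Ctx → Ty → Type
  | ne {Ψ : GCtx} {Γ : Ctx} {T : Ty} : Ne Ψ Γ T → Nf Ψ Γ T
  | zero {Ψ : GCtx} {Γ : Ctx} : Nf Ψ Γ .nat
  | succ {Ψ : GCtx} {Γ : Ctx} : Nf Ψ Γ .nat → Nf Ψ Γ .nat
  | box {Ψ : GCtx} {Γ : Ctx} {Δ : CCtx} {T : CTy} : Exp0 Ψ Δ T → Nf Ψ Γ (.box Δ T)
  | lam {Ψ : GCtx} {Γ : Ctx} {S T : Ty} : Nf Ψ (S :: Γ) T → Nf Ψ Γ (.arr S T)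

end

mutual

/-- Weakening of neutral forms. -/
def Ne.wk : {Ψ Ψ' : GCtx} → {Γ Γ' : Ctx} → {T : Ty} → Wk Ψ' Ψ → Wk Γ' Γ → Ne Ψ Γ T → Ne Ψ' Γ' T
  | _, _, _, _, _, _, τ, .var x => .var (τ.var x)
  | _, _, _, _, _, γ, τ, .gvar u θ => .gvar (γ.var u) (fun A x => (θ A x).wk γ τ)
  | _, _, _, _, _, γ, τ, .app v w => .app (v.wk γ τ) (w.wk γ τ)
  | _, _, _, _, _, γ, τ, .letbox v w => .letbox (v.wk γ τ) (w.wk (.keep _ γ) τ)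
  | _, _, _, _, _, γ, τ, .matchNe v r =>
      .matchNe (v.wk γ τ) (fun p => (r p).wk (γ.keeps p.binds) τ)
  | _, _, _, _, _, γ, τ, .matchGvar u δ r =>
      .matchGvar (γ.var u) (fun A x => (δ A x).wk γ (Wk.id _))
        (fun p => (r p).wk (γ.keeps p.binds) τ)

/-- Weakening of normal forms. -/
def Nf.wk : {Ψ Ψ' : GCtx} → {Γ Γ' : Ctx} → {T : Ty} → Wk Ψ' Ψ → Wk Γ' Γ → Nf Ψ Γ T → Nf Ψ' Γ' T
  | _, _, _, _, _, γ, τ, .ne v => .ne (v.wk γ τ)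
  | _, _, _, _, _, _, _, .zero => .zero
  | _, _, _, _, _, γ, τ, .succ w => .succ (w.wk γ τ)
  | _, _, _, _, _, γ, _, .box t => .box (t.wk γ (Wk.id _))
  | _, _, _, _, _, γ, τ, .lam w => .lam (w.wk γ (.keep _ τ))

end

/-! ## Interpretation of types and contexts -/

/-- The interpretation `⟦T⟧` at the dual context `Ψ; Γ`. -/
def Sem : Ty → GCtx → Ctx → Type
  | .nat, Ψ, Γ => Nf Ψ Γ .nat
  | .box Δ T, Ψ, Γ => Nf Ψ Γ (.box Δ T)
  | .arr S T, Ψ, Γ => ∀ (Ψ' : GCtx) (Γ' : Ctx), Wk Ψ' Ψ → Wk Γ' Γ → Sem S Ψ' Γ' → Sem T Ψ' Γ'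

/-- The functorial action `a[γ; τ]` on `⟦T⟧`. -/
def Sem.wk {Ψ Ψ' : GCtx} {Γ Γ' : Ctx} (γ : Wk Ψ' Ψ) (τ : Wk Γ' Γ) :
    (T : Ty) → Sem T Ψ Γ → Sem T Ψ' Γ'
  | .nat, a => Nf.wk γ τ a
  | .box _ _, a => Nf.wk γ τ a
  | .arr _ _, f => fun Ψ'' Γ'' γ' τ' a => f Ψ'' Γ'' (γ.comp γ') (τ.comp τ') a

mutual

/-- Reification `↓`. -/
def reify : (T : Ty) → {Ψ : GCtx} → {Γ : Ctx} → Sem T Ψ Γ → Nf Ψ Γ T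
  | .nat, _, _, a => a
  | .box _ _, _, _, a => a
  | .arr S T, Ψ, Γ, f =>
      .lam (reify T (f Ψ (S :: Γ) (Wk.id Ψ) (.drop S (Wk.id Γ)) (reflect S (.var .z))))

/-- Reflection `↑`. -/
def reflect : (T : Ty) → {Ψ : GCtx} → {Γ : Ctx} → Ne Ψ Γ T → Sem T Ψ Γ
  | .nat, _, _, v => Nf.ne v
  | .box _ _, _, _, v => Nf.ne v
  | .arr S T, _, _, v => fun _ _ γ τ a => reflect T (.app (v.wk γ τ) (reify S a))

end

/-- The interpretation `⟦Δ⟧` of a core local context at `Ψ; Γ`. -/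
abbrev CEnv (Δ : CCtx) (Ψ : GCtx) (Γ : Ctx) : Type := ∀ A : CTy, Var Δ A → Sem A.toTy Ψ Γ

/-- The interpretation `⟦Δ⟧` of a local context at `Ψ; Γ`. -/
abbrev Env (Δ : Ctx) (Ψ : GCtx) (Γ : Ctx) : Type := ∀ A : Ty, Var Δ A → Sem A Ψ Γ

/-- `(ρ, a)`. -/
def CEnv.cons {Δ : CCtx} {Ψ : GCtx} {Γ : Ctx} {S : CTy} (ρ : CEnv Δ Ψ Γ) (a : Sem S.toTy Ψ Γ) :
    CEnv (S :: Δ) Ψ Γ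
  | _, .z => a
  | _, .s x => ρ _ x

/-- `ρ[γ; τ]`. -/
def CEnv.wk {Δ : CCtx} {Ψ Ψ' : GCtx} {Γ Γ' : Ctx} (γ : Wk Ψ' Ψ) (τ : Wk Γ' Γ) (ρ : CEnv Δ Ψ Γ) :
    CEnv Δ Ψ' Γ' := fun A x => Sem.wk γ τ A.toTy (ρ A x)

/-- `(ρ, a)`. -/
def Env.cons {Δ : Ctx} {Ψ : GCtx} {Γ : Ctx} {S : Ty} (ρ : Env Δ Ψ Γ) (a : Sem S Ψ Γ) :
    Env (S :: Δ) Ψ Γ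
  | _, .z => a
  | _, .s x => ρ _ x

/-- `ρ[γ; τ]`. -/
def Env.wk {Δ : Ctx} {Ψ Ψ' : GCtx} {Γ Γ' : Ctx} (γ : Wk Ψ' Ψ) (τ : Wk Γ' Γ) (ρ : Env Δ Ψ Γ) :
    Env Δ Ψ' Γ' := fun A x => Sem.wk γ τ A (ρ A x)

/-- The identity environment `↑` of `⟦Γ⟧` at `Ψ; Γ`. -/
def Env.id (Ψ : GCtx) : (Γ : Ctx) → Env Γ Ψ Γ
  | [] => fun _ x => nomatch x
  | S :: Γ => Env.cons (Env.wk (Wk.id Ψ) (.drop S (Wk.id Γ)) (Env.id Ψ Γ)) (reflect S (.var .z))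

/-! ## Interpretation of terms -/

/-- The interpretation `⟦t⟧⁰` at `Ψ; Γ`; global contexts are interpreted by weakenings. -/
def interp0 {Φ : GCtx} : {Ψ : GCtx} → {Δ : CCtx} → {Γ : Ctx} → {T : CTy} → Exp0 Φ Δ T →
    Wk Ψ Φ → CEnv Δ Ψ Γ → Sem T.toTy Ψ Γ
  | _, _, _, _, .var x, _, ρ => ρ _ x
  | _, _, _, _, .gvar (T := T) u δ, γ, ρ =>
      reflect T.toTy (.gvar (γ.var u) (fun A x => reify A.toTy (interp0 (δ A x) γ ρ)))
  | _, _, _, _, .zero, _, _ => Nf.zero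
  | _, _, _, _, .succ t, γ, ρ => Nf.succ (interp0 t γ ρ)
  | _, _, _, _, .lam t, γ, ρ =>
      fun _ _ γ' τ' a => interp0 t (γ.comp γ') (CEnv.cons (CEnv.wk γ' τ' ρ) a)
  | Ψ, _, Γ, _, .app t s, γ, ρ =>
      (interp0 t γ ρ) Ψ Γ (Wk.id Ψ) (Wk.id Γ) (interp0 s γ ρ)

/-- Interpretations of the bodies of a family of branches that is typed in `Φ; Δ`. -/
abbrev SemBranches (Φ : GCtx) (Δ : Ctx) (Δ' : CCtx) (T : CTy) (T' : Ty) : Type :=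
  ∀ (p : Pat Δ' T) (Ψ : GCtx) (Γ : Ctx), GSub Ψ (p.binds ++ Φ) → Env Δ Ψ Γ → Sem T' Ψ Γ

/-- The function `nfbranch`, which normalizes all branches. -/
def nfbranch {Φ Ψ : GCtx} {Δ Γ : Ctx} {Δ' : CCtx} {T : CTy} {T' : Ty}
    (b : SemBranches Φ Δ Δ' T T') (σ : GSub Ψ Φ) (ρ : Env Δ Ψ Γ) (p : Pat Δ' T) :
    Nf (p.binds ++ Ψ) Γ T' :=
  reify T' (b p (p.binds ++ Ψ) Γ (GSub.lifts σ p.binds)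
    (Env.wk (Wk.drops Ψ p.binds) (Wk.id Γ) ρ))

/-- The function `match`, which selects a branch by the shape of a piece of code. -/
def matchCode {Φ Ψ : GCtx} {Δ Γ : Ctx} {Δ' : CCtx} {T' : Ty} : {T : CTy} → Exp0 Ψ Δ' T →
    SemBranches Φ Δ Δ' T T' → GSub Ψ Φ → Env Δ Ψ Γ → Sem T' Ψ Γ
  | _, .var x, b, σ, ρ => b (.var x) Ψ Γ σ ρ
  | _, .zero, b, σ, ρ => b .zero Ψ Γ σ ρ
  | _, .succ s, b, σ, ρ => b .succ Ψ Γ (GSub.cons σ s) ρ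
  | _, .lam s, b, σ, ρ => b .lam Ψ Γ (GSub.cons σ s) ρ
  | _, .app (S := S) t s, b, σ, ρ => b (.app S) Ψ Γ (GSub.cons (GSub.cons σ t) s) ρ
  | _, .gvar u δ, b, σ, ρ => reflect T' (.matchGvar u δ (nfbranch b σ ρ))

/-- Case distinction on the value of the scrutinee of `letbox`. -/
def letboxSem {Φ Ψ : GCtx} {Δ Γ : Ctx} {Δ' : CCtx} {T : CTy} {T' : Ty}
    (b : ∀ (Ψ' : GCtx) (Γ' : Ctx), GSub Ψ' (⟨Δ', T⟩ :: Φ) → Env Δ Ψ' Γ' → Sem T' Ψ' Γ')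
    (σ : GSub Ψ Φ) (ρ : Env Δ Ψ Γ) : Nf Ψ Γ (.box Δ' T) → Sem T' Ψ Γ
  | .box t => b Ψ Γ (GSub.cons σ t) ρ
  | .ne v => reflect T' (.letbox v (reify T' (b (⟨Δ', T⟩ :: Ψ) Γ (GSub.lift _ σ)
      (Env.wk (.drop _ (Wk.id Ψ)) (Wk.id Γ) ρ))))

/-- Case distinction on the value of the scrutinee of `match`. -/
def matchSem {Φ Ψ : GCtx} {Δ Γ : Ctx} {Δ' : CCtx} {T : CTy} {T' : Ty}
    (b : SemBranches Φ Δ Δ' T T') (σ : GSub Ψ Φ) (ρ : Env Δ Ψ Γ) :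
    Nf Ψ Γ (.box Δ' T) → Sem T' Ψ Γ
  | .box s => matchCode s b σ ρ
  | .ne v => reflect T' (.matchNe v (nfbranch b σ ρ))

/-- The interpretation `⟦t⟧¹` at `Ψ; Γ`; global contexts are interpreted by global
substitutions. -/
def interp1 : {Φ Ψ : GCtx} → {Δ Γ : Ctx} → {T : Ty} → Exp1 Φ Δ T → GSub Ψ Φ → Env Δ Ψ Γ →
    Sem T Ψ Γ
  | _, _, _, _, _, .var x, _, ρ => ρ _ x
  | _, Ψ, _, _, _, .gvar u δ, σ, ρ =>
      interp0 (σ _ _ u) (Wk.id Ψ) (fun A x => interp1 (δ A x) σ ρ)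
  | _, _, _, _, _, .zero, _, _ => Nf.zero
  | _, _, _, _, _, .succ t, σ, ρ => Nf.succ (interp1 t σ ρ)
  | _, _, _, _, _, .lam t, σ, ρ =>
      fun _ _ γ τ a => interp1 t (GSub.wk γ σ) (Env.cons (Env.wk γ τ ρ) a)
  | _, Ψ, _, Γ, _, .app t s, σ, ρ =>
      (interp1 t σ ρ) Ψ Γ (Wk.id Ψ) (Wk.id Γ) (interp1 s σ ρ)
  | _, _, _, _, _, .box t, σ, _ => Nf.box (t.gsubst σ)
  | _, _, _, _, _, .letbox s t, σ, ρ =>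
      letboxSem (fun _ _ σ' ρ' => interp1 t σ' ρ') σ ρ (interp1 s σ ρ)
  | _, _, _, _, _, .matchc s b, σ, ρ =>
      matchSem (fun p _ _ σ' ρ' => interp1 (b p) σ' ρ') σ ρ (interp1 s σ ρ)

/-- Normalization by evaluation. -/
def nbe {Ψ : GCtx} {Γ : Ctx} {T : Ty} (t : Exp1 Ψ Γ T) : Nf Ψ Γ T :=
  reify T (interp1 t (GSub.id Ψ) (Env.id Ψ Γ))

end Layered

namespace Layered

/-! ## Weakenings -/

namespace Wk

variable {α : Type}

-- Equivalent terms should have the same value, and reading a value back should then give the same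
-- normal form. Plain equality of values is too fine: a function value is an arbitrary family
-- indexed by weakenings, and substitution under a binder and η both need that family to commute
-- with weakening. Values are therefore compared by the partial equivalence `Rel`: equality at `nat`
-- and at contextual types; at function types, related results on related arguments, together with
-- naturality, up to `Rel`, of each of the two functions. `reify_reflect_spec` supplies the exit and
-- the entry: related values reify to equal normal forms, and reflected neutrals, hence the identity
-- environment, are self-related.
--
-- The core is the fundamental property `Eqv1.interp1_rel`, by induction on the equivalence.
-- Congruence rules rest on `interp1_rel_and_wk`: interpretation preserves `Rel` and is natural,
-- proved together because naturality is part of `Rel`. The β rules rest on the semantic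
-- substitution lemmas `interp1_lsubst` and `interp1_gsubst`, and η on naturality.
--
-- Code is easier than programs. Layer 0 has no computation rules, so its equivalence is syntactic
-- identity (`Eqv0.eq`). Related scrutinees of `letbox` and `match` are thus literally equal, and
-- both sides take the same branch. Global substitutions are syntactic and compose strictly
-- (`Exp0.gsubst_gsubst`). The layers meet at global variables used at layer 1, where substituted
-- code is executed; `interp1_run` shows that executing code syntactically and evaluating it at
-- layer 0 agree.

@[simp] theorem id_comp : ∀ {Γ Δ : List α} (τ : Wk Γ Δ), (id Δ).comp τ = τ
  | _, _, .nil => rfl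
  | _, _, .keep a τ => by simp [id, comp, id_comp τ]
  | _, _, .drop a τ => by simp [comp, id_comp τ]

@[simp] theorem comp_id : ∀ {Γ Δ : List α} (τ : Wk Γ Δ), τ.comp (id Γ) = τ
  | _, _, .nil => rfl
  | _, _, .keep a τ => by simp [id, comp, comp_id τ]
  | _, _, .drop a τ => by simp [id, comp, comp_id τ]

theorem comp_assoc : ∀ {Γ₃ Γ₂ Γ₁ Γ₀ : List α} (τ : Wk Γ₂ Γ₃) (τ' : Wk Γ₁ Γ₂) (τ'' : Wk Γ₀ Γ₁),
    (τ.comp τ').comp τ'' = τ.comp (τ'.comp τ'')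
  | _, _, _, _, _, _, .nil => by simp [comp]
  | _, _, _, _, τ, τ', .drop a τ'' => by simp [comp, comp_assoc τ τ' τ'']
  | _, _, _, _, τ, .drop _ τ', .keep _ τ'' => by simp [comp, comp_assoc τ τ' τ'']
  | _, _, _, _, .keep _ τ, .keep _ τ', .keep _ τ'' => by simp [comp, comp_assoc τ τ' τ'']
  | _, _, _, _, .drop _ τ, .keep _ τ', .keep _ τ'' => by simp [comp, comp_assoc τ τ' τ'']

@[simp] theorem var_id : ∀ {Γ : List α} {a : α} (x : Var Γ a), (id Γ).var x = x
  | _, _, .z => rfl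
  | _, _, .s x => by simp [id, var, var_id x]

theorem var_comp : ∀ {Γ₂ Γ₁ Γ₀ : List α} (τ : Wk Γ₁ Γ₂) (τ' : Wk Γ₀ Γ₁) {a : α} (x : Var Γ₂ a),
    (τ.comp τ').var x = τ'.var (τ.var x)
  | _, _, _, .nil, .nil, _, x => nomatch x
  | _, _, _, τ, .drop _ τ', _, x => by simp [comp, var, var_comp τ τ' x]
  | _, _, _, .drop _ τ, .keep _ τ', _, x => by simp [comp, var, var_comp τ τ' x]
  | _, _, _, .keep _ _, .keep _ _, _, .z => rfl
  | _, _, _, .keep _ τ, .keep _ τ', _, .s x => by simp [comp, var, var_comp τ τ' x]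

@[simp] theorem keeps_id (Γ : List α) : ∀ Ξ : List α, (id Γ).keeps Ξ = id (Ξ ++ Γ)
  | [] => rfl
  | a :: Ξ => by simp [keeps, keeps_id Γ Ξ, id]

theorem keeps_comp {Γ₂ Γ₁ Γ₀ : List α} (τ : Wk Γ₁ Γ₂) (τ' : Wk Γ₀ Γ₁) :
    ∀ Ξ : List α, (τ.comp τ').keeps Ξ = (τ.keeps Ξ).comp (τ'.keeps Ξ)
  | [] => rfl
  | a :: Ξ => by simp [keeps, keeps_comp τ τ' Ξ, comp]

theorem drops_comp_keeps {Γ Δ : List α} (τ : Wk Γ Δ) :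
    ∀ Ξ : List α, (drops Δ Ξ).comp (τ.keeps Ξ) = τ.comp (drops Γ Ξ)
  | [] => by simp [drops, keeps]
  | a :: Ξ => by simp [drops, keeps, drops_comp_keeps τ Ξ, comp]

end Wk

/-! ## Substitution for code -/

/-- Precomposition of a global substitution with a weakening. -/
def GSub.comap {Ψ Φ Φ' : GCtx} (γ : Wk Φ Φ') (σ : GSub Ψ Φ) : GSub Ψ Φ' :=
  fun _ _ u => σ _ _ (γ.var u)

/-- Composition of global substitutions. -/
def GSub.comp {Ψ Φ Ξ : GCtx} (σ' : GSub Φ Ξ) (σ : GSub Ψ Φ) : GSub Ψ Ξ :=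
  fun _ _ u => (σ' _ _ u).gsubst σ

namespace Exp0

variable {Ψ Ψ' Ψ'' Φ : GCtx}

@[simp] theorem wk_id {Γ : CCtx} {T : CTy} (t : Exp0 Ψ Γ T) : t.wk (Wk.id Ψ) (Wk.id Γ) = t := by
  induction t with
  | lam t ih => simpa [wk, Wk.id] using ih
  | _ => simp_all [wk]

theorem wk_wk (γ : Wk Ψ' Ψ) (γ' : Wk Ψ'' Ψ') {Γ Γ' Γ'' : CCtx} {T : CTy} (τ : Wk Γ' Γ)
    (τ' : Wk Γ'' Γ') (t : Exp0 Ψ Γ T) :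
    (t.wk γ τ).wk γ' τ' = t.wk (γ.comp γ') (τ.comp τ') := by
  induction t generalizing Γ' Γ'' with
  | lam t ih => simp [wk, ih, Wk.comp]
  | _ => simp_all [wk, Wk.var_comp]

theorem lsubst_wk {Γ Γ' Δ : CCtx} {T : CTy} (τ : Wk Γ' Γ) (δ : Sub0 Ψ Δ Γ') (t : Exp0 Ψ Γ T) :
    (t.wk (Wk.id Ψ) τ).lsubst δ = t.lsubst (fun _ x => δ _ (τ.var x)) := by
  induction t generalizing Γ' Δ with
  | lam t ih =>
    simp only [wk, lsubst, ih]
    congr 2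
    funext A x
    cases x <;> rfl
  | _ => simp_all [wk, lsubst]

/-- The two weakenings travel differently: the local one acts only on the substitution, whereas the
global one also reaches the global variables of `t`. -/
theorem wk_lsubst (γ : Wk Ψ' Ψ) {Γ Γ' Δ : CCtx} {T : CTy} (τ : Wk Γ' Γ) (δ : Sub0 Ψ Γ Δ)
    (t : Exp0 Ψ Δ T) :
    (t.lsubst δ).wk γ τ = (t.wk γ (Wk.id Δ)).lsubst (fun _ x => (δ _ x).wk γ τ) := by
  induction t generalizing Γ Γ' with
  | lam t ih =>
    simp only [wk, lsubst, ih]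
    congr 2
    funext A x
    cases x <;> simp [Sub0.lift, wk, wk_wk, Wk.comp, Wk.var]
  | _ => simp_all [wk, lsubst]

/-- Under a binder the composite of two lifted substitutions is the lift of the composite, because
`lsubst_wk` and `wk_lsubst` move the weakening by the new variable past both. -/
theorem lsubst_lsubst {Γ Γ' Δ : CCtx} {T : CTy} (δ' : Sub0 Ψ Γ' Γ) (δ : Sub0 Ψ Γ Δ)
    (t : Exp0 Ψ Δ T) :
    (t.lsubst δ).lsubst δ' = t.lsubst (fun _ x => (δ _ x).lsubst δ') := by
  induction t generalizing Γ Γ' with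
  | lam t ih =>
    simp only [lsubst, ih]
    congr 2
    funext A x
    cases x <;> simp [Sub0.lift, lsubst, lsubst_wk, wk_lsubst, Wk.var]
  | _ => simp_all [lsubst]

theorem lsubst_var {Γ : CCtx} {T : CTy} (t : Exp0 Ψ Γ T) : t.lsubst (fun _ x => .var x) = t := by
  induction t with
  | lam t ih =>
    simp only [lsubst]
    congr 1
    refine Eq.trans ?_ ih
    congr 1
    funext A x
    cases x <;> simp [Sub0.lift, wk, Wk.var]
  | _ => simp_all [lsubst]

/-- The code `σ u` lives in its own local context, so `τ` meets only the local substitution attached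
to `u`; this is why `σ` is changed by `γ` alone. -/
theorem wk_gsubst (γ : Wk Ψ' Ψ) (σ : GSub Ψ Φ) {Γ Γ' : CCtx} {T : CTy} (τ : Wk Γ' Γ)
    (t : Exp0 Φ Γ T) :
    (t.gsubst σ).wk γ τ = (t.wk (Wk.id Φ) τ).gsubst (σ.wk γ) := by
  induction t generalizing Γ' with
  | gvar u δ ih => simp [wk, gsubst, wk_lsubst, ih, GSub.wk]
  | _ => simp_all [wk, gsubst]

theorem gsubst_wk (γ : Wk Φ Ψ) (σ : GSub Ψ' Φ) {Γ Γ' : CCtx} {T : CTy} (τ : Wk Γ' Γ)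
    (t : Exp0 Ψ Γ T) :
    (t.wk γ τ).gsubst σ = (t.gsubst (σ.comap γ)).wk (Wk.id Ψ') τ := by
  induction t generalizing Γ' with
  | gvar u δ ih => simp [wk, gsubst, wk_lsubst, ih, GSub.comap]
  | _ => simp_all [wk, gsubst]

/-- At a global variable both sides substitute locally into `σ u`, and `lsubst_lsubst` merges the
two substitutions. Local binders leave `σ` untouched. -/
theorem gsubst_lsubst (σ : GSub Ψ Φ) {Γ Δ : CCtx} {T : CTy} (δ : Sub0 Φ Γ Δ) (t : Exp0 Φ Δ T) :
    (t.lsubst δ).gsubst σ = (t.gsubst σ).lsubst (fun _ x => (δ _ x).gsubst σ) := by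
  induction t generalizing Γ with
  | lam t ih =>
    simp only [lsubst, gsubst, ih]
    congr 2
    funext A x
    cases x with
    | z => rfl
    | s x =>
      simp only [Sub0.lift, gsubst_wk]
      congr 2
      funext Δ T u
      simp [GSub.comap]
  | gvar u δ ih => simp [lsubst, gsubst, lsubst_lsubst, ih]
  | _ => simp_all [lsubst, gsubst]

theorem gsubst_gsubst (σ : GSub Ψ Φ) (σ' : GSub Φ Ψ') {Γ : CCtx} {T : CTy} (t : Exp0 Ψ' Γ T) :
    (t.gsubst σ').gsubst σ = t.gsubst (σ'.comp σ) := by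
  induction t with
  | gvar u δ ih => simp [gsubst, gsubst_lsubst, ih, GSub.comp]
  | _ => simp_all [gsubst]

end Exp0

/-! ## Global substitutions -/

namespace GSub

variable {Ψ Ψ' Ψ'' Φ Φ' : GCtx}

/-- Extension of a global substitution by one for the context `Ξ`. -/
def append (σ : GSub Ψ Φ) : (Ξ : GCtx) → GSub Ψ Ξ → GSub Ψ (Ξ ++ Φ)
  | [], _ => σ
  | _ :: Ξ, ξ => cons (append σ Ξ (fun _ _ u => ξ _ _ (.s u))) (ξ _ _ .z)

@[simp] theorem wk_id (σ : GSub Ψ Φ) : σ.wk (Wk.id Ψ) = σ := by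
  funext Δ T u
  simp [wk]

theorem wk_wk (γ : Wk Ψ' Ψ) (γ' : Wk Ψ'' Ψ') (σ : GSub Ψ Φ) :
    (σ.wk γ).wk γ' = σ.wk (γ.comp γ') := by
  funext Δ T u
  simp [wk, Exp0.wk_wk]

@[simp] theorem comap_id (σ : GSub Ψ Φ) : σ.comap (Wk.id Φ) = σ := by
  funext Δ T u
  simp [comap]

theorem comp_wk (γ : Wk Ψ' Ψ) (σ' : GSub Φ Φ') (σ : GSub Ψ Φ) :
    σ'.comp (σ.wk γ) = (σ'.comp σ).wk γ := by
  funext Δ T u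
  simp [comp, wk, Exp0.wk_gsubst]

@[simp] theorem id_comp (σ : GSub Ψ Φ) : (id Φ).comp σ = σ := by
  funext Δ T u
  exact Exp0.lsubst_var _

theorem cons_comp {Δ : CCtx} {T : CTy} (σ' : GSub Φ Φ') (t : Exp0 Φ Δ T) (σ : GSub Ψ Φ) :
    (cons σ' t).comp σ = cons (σ'.comp σ) (t.gsubst σ) := by
  funext Δ T u
  cases u <;> rfl

theorem wk_cons {Δ : CCtx} {T : CTy} (γ : Wk Ψ' Ψ) (σ : GSub Ψ Φ) (t : Exp0 Ψ Δ T) :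
    (cons σ t).wk γ = cons (σ.wk γ) (t.wk γ (Wk.id Δ)) := by
  funext Δ T u
  cases u <;> rfl

theorem wk_lift (d : GDecl) (γ : Wk Ψ' Ψ) (σ : GSub Ψ Φ) :
    (lift d σ).wk (.keep d γ) = lift d (σ.wk γ) := by
  funext Δ T u
  cases u with
  | z => simp [lift, cons, wk, Exp0.wk, Wk.var, Sub0.id]; rfl
  | s u => simp [lift, cons, wk, Exp0.wk_wk, Wk.comp]

theorem wk_lifts (γ : Wk Ψ' Ψ) (σ : GSub Ψ Φ) :
    ∀ Ξ : GCtx, (lifts σ Ξ).wk (γ.keeps Ξ) = lifts (σ.wk γ) Ξ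
  | [] => rfl
  | d :: Ξ => by simp [lifts, Wk.keeps, wk_lift, wk_lifts γ σ Ξ]

theorem comap_keep_lift (d : GDecl) (γ : Wk Φ Φ') (σ : GSub Ψ Φ) :
    (lift d σ).comap (.keep d γ) = lift d (σ.comap γ) := by
  funext Δ T u
  cases u <;> rfl

theorem comap_keeps_lifts (γ : Wk Φ Φ') (σ : GSub Ψ Φ) :
    ∀ Ξ : GCtx, (lifts σ Ξ).comap (γ.keeps Ξ) = lifts (σ.comap γ) Ξ
  | [] => rfl
  | d :: Ξ => by simp [lifts, Wk.keeps, comap_keep_lift, comap_keeps_lifts γ σ Ξ]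

theorem comap_keep_cons {Δ : CCtx} {T : CTy} (γ : Wk Φ Φ') (σ : GSub Ψ Φ) (t : Exp0 Ψ Δ T) :
    (cons σ t).comap (.keep _ γ) = cons (σ.comap γ) t := by
  funext Δ T u
  cases u <;> rfl

theorem comap_keeps_append (γ : Wk Φ Φ') (σ : GSub Ψ Φ) :
    ∀ (Ξ : GCtx) (ξ : GSub Ψ Ξ), (append σ Ξ ξ).comap (γ.keeps Ξ) = append (σ.comap γ) Ξ ξ
  | [], _ => rfl
  | ⟨Δ, T⟩ :: Ξ, ξ => by simp [append, Wk.keeps, comap_keep_cons, comap_keeps_append γ σ Ξ]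

theorem comap_drop {d : GDecl} (γ : Wk Φ Φ') (σ : GSub Ψ (d :: Φ)) :
    σ.comap (.drop d γ) = comap γ (fun _ _ u => σ _ _ (.s u)) := by
  funext Δ T u
  simp [comap, Wk.var]

/-- With `comap_drops_append`, this covers the two ways in which the variables of a pattern are
filled: by themselves under a stuck `match`, or by pieces of code. In both cases the part of the
substitution below them is recovered. -/
theorem comap_drops_lifts (σ : GSub Ψ Φ) :
    ∀ Ξ : GCtx, (lifts σ Ξ).comap (Wk.drops Φ Ξ) = σ.wk (Wk.drops Ψ Ξ)
  | [] => by simp [lifts, Wk.drops]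
  | d :: Ξ => by
    have h : (σ.wk (Wk.drops Ψ Ξ)).wk (.drop d (Wk.id _)) = σ.wk (Wk.drops Ψ (d :: Ξ)) := by
      simp [wk_wk, Wk.comp, Wk.drops]
    rw [← h, ← comap_drops_lifts σ Ξ, Wk.drops, comap_drop]
    rfl

theorem comap_drops_append (σ : GSub Ψ Φ) :
    ∀ (Ξ : GCtx) (ξ : GSub Ψ Ξ), (append σ Ξ ξ).comap (Wk.drops Φ Ξ) = σ
  | [], _ => by simp [append, Wk.drops]
  | d :: Ξ, ξ => by
    rw [Wk.drops, comap_drop]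
    exact comap_drops_append σ Ξ _

/-- Going under a global binder and then instantiating it with `t` is one extended substitution: the
code `t` cancels the weakening that `lift` put on `σ'`. -/
theorem lift_comp_cons {Δ : CCtx} {T : CTy} (σ' : GSub Φ Φ') (σ : GSub Ψ Φ) (t : Exp0 Ψ Δ T) :
    (lift ⟨Δ, T⟩ σ').comp (cons σ t) = cons (σ'.comp σ) t := by
  funext Δ T u
  cases u with
  | z => exact Exp0.lsubst_var _
  | s u =>
    simp only [comp, lift, cons, wk, Exp0.gsubst_wk, Exp0.wk_id, comap_drop]
    exact congrArg (Exp0.gsubst · _) (comap_id σ)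

theorem lifts_comp_append (σ' : GSub Φ Φ') (σ : GSub Ψ Φ) :
    ∀ (Ξ : GCtx) (ξ : GSub Ψ Ξ), (lifts σ' Ξ).comp (append σ Ξ ξ) = append (σ'.comp σ) Ξ ξ
  | [], _ => rfl
  | ⟨Δ, T⟩ :: Ξ, ξ => by simp [append, lifts, lift_comp_cons, lifts_comp_append σ' σ Ξ]

theorem lift_comp_lift (d : GDecl) (σ' : GSub Φ Φ') (σ : GSub Ψ Φ) :
    (lift d σ').comp (lift d σ) = lift d (σ'.comp σ) := by
  exact (lift_comp_cons σ' _ _).trans (congrArg (cons · _) (comp_wk _ σ' σ))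

theorem lifts_comp_lifts (σ' : GSub Φ Φ') (σ : GSub Ψ Φ) :
    ∀ Ξ : GCtx, (lifts σ' Ξ).comp (lifts σ Ξ) = lifts (σ'.comp σ) Ξ
  | [] => rfl
  | d :: Ξ => by simp [lifts, lift_comp_lift, lifts_comp_lifts σ' σ Ξ]

theorem wk_append (γ : Wk Ψ' Ψ) (σ : GSub Ψ Φ) :
    ∀ (Ξ : GCtx) (ξ : GSub Ψ Ξ), (append σ Ξ ξ).wk γ = append (σ.wk γ) Ξ (ξ.wk γ)
  | [], _ => rfl
  | d :: Ξ, ξ => by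
    simp [append, wk_cons, wk_append γ σ Ξ]
    rfl

end GSub

/-! ## Functoriality of normal forms and of the interpretation of types -/

mutual

theorem Ne.wk_id : ∀ {Ψ : GCtx} {Γ : Ctx} {T : Ty} (v : Ne Ψ Γ T),
    v.wk (Wk.id Ψ) (Wk.id Γ) = v
  | _, _, _, .var x => by simp [Ne.wk]
  | _, _, _, .gvar u θ => by
    simp only [Ne.wk, Wk.var_id]
    exact congrArg _ (funext fun A => funext fun x => Nf.wk_id (θ A x))
  | _, _, _, .app v w => by simp [Ne.wk, Ne.wk_id v, Nf.wk_id w]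
  | _, _, _, .letbox v w => by
    simp only [Ne.wk, Ne.wk_id v]
    -- `Wk.keep _ (Wk.id Ψ)` is by definition the identity on the extended global context.
    exact congrArg _ (Nf.wk_id w)
  | _, _, _, .matchNe v r => by
    simp only [Ne.wk, Ne.wk_id v, Wk.keeps_id]
    exact congrArg _ (funext fun p => Nf.wk_id (r p))
  | _, _, _, .matchGvar u δ r => by
    simp only [Ne.wk, Wk.keeps_id, Exp0.wk_id, Wk.var_id]
    exact congrArg _ (funext fun p => Nf.wk_id (r p))

theorem Nf.wk_id : ∀ {Ψ : GCtx} {Γ : Ctx} {T : Ty} (w : Nf Ψ Γ T),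
    w.wk (Wk.id Ψ) (Wk.id Γ) = w
  | _, _, _, .ne v => by simp [Nf.wk, Ne.wk_id v]
  | _, _, _, .zero => by simp [Nf.wk]
  | _, _, _, .succ w => by simp [Nf.wk, Nf.wk_id w]
  | _, _, _, .box t => by simp [Nf.wk]
  | _, _, _, .lam w => by
    simp only [Nf.wk]
    exact congrArg _ (Nf.wk_id w)

end

mutual

theorem Ne.wk_wk : ∀ {Ψ Ψ' Ψ'' : GCtx} {Γ Γ' Γ'' : Ctx} {T : Ty} (γ : Wk Ψ' Ψ) (γ' : Wk Ψ'' Ψ')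
    (τ : Wk Γ' Γ) (τ' : Wk Γ'' Γ') (v : Ne Ψ Γ T),
    (v.wk γ τ).wk γ' τ' = v.wk (γ.comp γ') (τ.comp τ')
  | _, _, _, _, _, _, _, _, _, _, _, .var x => by simp [Ne.wk, Wk.var_comp]
  | _, _, _, _, _, _, _, γ, γ', τ, τ', .gvar u θ => by
    simp only [Ne.wk, Wk.var_comp]
    exact congrArg _ (funext fun A => funext fun x => Nf.wk_wk γ γ' τ τ' (θ A x))
  | _, _, _, _, _, _, _, γ, γ', τ, τ', .app v w => by
    simp [Ne.wk, Ne.wk_wk γ γ' τ τ' v, Nf.wk_wk γ γ' τ τ' w]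
  | _, _, _, _, _, _, _, γ, γ', τ, τ', .letbox v w => by
    simp [Ne.wk, Ne.wk_wk γ γ' τ τ' v, Nf.wk_wk (.keep _ γ) (.keep _ γ') τ τ' w, Wk.comp]
  | _, _, _, _, _, _, _, γ, γ', τ, τ', .matchNe v r => by
    simp only [Ne.wk, Ne.wk_wk γ γ' τ τ' v, Wk.keeps_comp]
    exact congrArg _ (funext fun p => Nf.wk_wk _ _ τ τ' (r p))
  | _, _, _, _, _, _, _, γ, γ', τ, τ', .matchGvar u δ r => by
    simp only [Ne.wk, Wk.keeps_comp, Exp0.wk_wk, Wk.var_comp, Wk.comp_id]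
    exact congrArg _ (funext fun p => Nf.wk_wk _ _ τ τ' (r p))

theorem Nf.wk_wk : ∀ {Ψ Ψ' Ψ'' : GCtx} {Γ Γ' Γ'' : Ctx} {T : Ty} (γ : Wk Ψ' Ψ) (γ' : Wk Ψ'' Ψ')
    (τ : Wk Γ' Γ) (τ' : Wk Γ'' Γ') (w : Nf Ψ Γ T),
    (w.wk γ τ).wk γ' τ' = w.wk (γ.comp γ') (τ.comp τ')
  | _, _, _, _, _, _, _, γ, γ', τ, τ', .ne v => by simp [Nf.wk, Ne.wk_wk γ γ' τ τ' v]
  | _, _, _, _, _, _, _, _, _, _, _, .zero => by simp [Nf.wk]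
  | _, _, _, _, _, _, _, γ, γ', τ, τ', .succ w => by simp [Nf.wk, Nf.wk_wk γ γ' τ τ' w]
  | _, _, _, _, _, _, _, _, _, _, _, .box t => by simp [Nf.wk, Exp0.wk_wk]
  | _, _, _, _, _, _, _, γ, γ', τ, τ', .lam w => by
    simp [Nf.wk, Nf.wk_wk γ γ' (.keep _ τ) (.keep _ τ') w, Wk.comp]

end

/-- The functor laws hold as equations even for non-natural function values, since the action only
precomposes the weakening argument. -/
theorem Sem.wk_id {Ψ : GCtx} {Γ : Ctx} : ∀ (T : Ty) (a : Sem T Ψ Γ),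
    Sem.wk (Wk.id Ψ) (Wk.id Γ) T a = a
  | .nat, a => Nf.wk_id a
  | .box _ _, a => Nf.wk_id a
  | .arr S T, f => by
    funext Ψ' Γ' γ τ a
    simp [Sem.wk]

theorem Sem.wk_wk {Ψ Ψ' Ψ'' : GCtx} {Γ Γ' Γ'' : Ctx} (γ : Wk Ψ' Ψ) (γ' : Wk Ψ'' Ψ')
    (τ : Wk Γ' Γ) (τ' : Wk Γ'' Γ') : ∀ (T : Ty) (a : Sem T Ψ Γ),
    Sem.wk γ' τ' T (Sem.wk γ τ T a) = Sem.wk (γ.comp γ') (τ.comp τ') T a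
  | .nat, a => Nf.wk_wk γ γ' τ τ' a
  | .box _ _, a => Nf.wk_wk γ γ' τ τ' a
  | .arr S T, f => by
    funext Ψ₀ Γ₀ γ₀ τ₀ a
    simp [Sem.wk, Wk.comp_assoc]

/-! ## The partial equivalence relation on the interpretation of types

Interpretations of function types contain functions that do not commute with weakenings, so
interpretations of equivalent terms are compared by a relation whose domain excludes them. -/

/-- The partial equivalence of semantic values: equality at base types; at function types,
functions that commute with weakenings and have related values at related arguments. -/
def Rel : (T : Ty) → {Ψ : GCtx} → {Γ : Ctx} → Sem T Ψ Γ → Sem T Ψ Γ → Prop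
  | .nat, _, _, a, a' => a = a'
  | .box _ _, _, _, a, a' => a = a'
  | .arr S T, Ψ, Γ, f, f' =>
    (∀ (Ψ' : GCtx) (Γ' : Ctx) (γ : Wk Ψ' Ψ) (τ : Wk Γ' Γ) (a a' : Sem S Ψ' Γ'), Rel S a a' →
      Rel T (f Ψ' Γ' γ τ a) (f' Ψ' Γ' γ τ a')) ∧
    (∀ (Ψ' : GCtx) (Γ' : Ctx) (γ : Wk Ψ' Ψ) (τ : Wk Γ' Γ) (a : Sem S Ψ' Γ'), Rel S a a →
      ∀ (Ψ'' : GCtx) (Γ'' : Ctx) (γ' : Wk Ψ'' Ψ') (τ' : Wk Γ'' Γ'),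
      Rel T (Sem.wk γ' τ' T (f Ψ' Γ' γ τ a))
        (f Ψ'' Γ'' (γ.comp γ') (τ.comp τ') (Sem.wk γ' τ' S a))) ∧
    (∀ (Ψ' : GCtx) (Γ' : Ctx) (γ : Wk Ψ' Ψ) (τ : Wk Γ' Γ) (a : Sem S Ψ' Γ'), Rel S a a →
      ∀ (Ψ'' : GCtx) (Γ'' : Ctx) (γ' : Wk Ψ'' Ψ') (τ' : Wk Γ'' Γ'),
      Rel T (Sem.wk γ' τ' T (f' Ψ' Γ' γ τ a))
        (f' Ψ'' Γ'' (γ.comp γ') (τ.comp τ') (Sem.wk γ' τ' S a)))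

namespace Rel

variable {Ψ Ψ' : GCtx} {Γ Γ' : Ctx}

/-- The two naturality clauses of `Rel` concern one function each, so symmetry just swaps them. -/
theorem symm : ∀ {T : Ty} {Ψ : GCtx} {Γ : Ctx} {a a' : Sem T Ψ Γ}, Rel T a a' → Rel T a' a
  | .nat, _, _, _, _, h => Eq.symm h
  | .box _ _, _, _, _, _, h => Eq.symm h
  | .arr _ _, _, _, _, _, h =>
    ⟨fun _ _ γ τ _ _ ha => symm (h.1 _ _ γ τ _ _ (symm ha)), h.2.2, h.2.1⟩

/-- Naturality is kept for the outer functions and forgotten for the middle one. The argument on the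
left, related to another one, is first related to itself. -/
theorem trans : ∀ {T : Ty} {Ψ : GCtx} {Γ : Ctx} {a b c : Sem T Ψ Γ},
    Rel T a b → Rel T b c → Rel T a c
  | .nat, _, _, _, _, _, h, h' => Eq.trans h h'
  | .box _ _, _, _, _, _, _, h, h' => Eq.trans h h'
  | .arr _ _, _, _, _, _, _, h, h' =>
    ⟨fun _ _ γ τ _ _ ha => trans (h.1 _ _ γ τ _ _ (trans ha (symm ha))) (h'.1 _ _ γ τ _ _ ha),
      h.2.1, h'.2.2⟩

theorem left {T : Ty} {a a' : Sem T Ψ Γ} (h : Rel T a a') : Rel T a a := h.trans h.symm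

theorem right {T : Ty} {a a' : Sem T Ψ Γ} (h : Rel T a a') : Rel T a' a' := h.symm.trans h

theorem congr_left {T : Ty} {a a' b : Sem T Ψ Γ} (h : Rel T a b) (e : a' = a) : Rel T a' b :=
  e ▸ h

/-- Values of functions that are related to themselves are all that has to be compared. -/
theorem arr {S T : Ty} {f f' : Sem (.arr S T) Ψ Γ} (hf : Rel (.arr S T) f f)
    (hf' : Rel (.arr S T) f' f')
    (h : ∀ (Ψ' : GCtx) (Γ' : Ctx) (γ : Wk Ψ' Ψ) (τ : Wk Γ' Γ) (a a' : Sem S Ψ' Γ'), Rel S a a' →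
      Rel T (f Ψ' Γ' γ τ a) (f' Ψ' Γ' γ τ a')) : Rel (.arr S T) f f' :=
  ⟨h, hf.2.1, hf'.2.1⟩

theorem wk (γ : Wk Ψ' Ψ) (τ : Wk Γ' Γ) : ∀ {T : Ty} {a a' : Sem T Ψ Γ}, Rel T a a' →
    Rel T (Sem.wk γ τ T a) (Sem.wk γ τ T a')
  | .nat, _, _, h => congrArg (Nf.wk γ τ) h
  | .box _ _, _, _, h => congrArg (Nf.wk γ τ) h
  | .arr S T, f, f', h => by
    refine ⟨fun _ _ γ' τ' a a' ha => h.1 _ _ _ _ _ _ ha, fun _ _ γ' τ' a ha _ _ γ'' τ'' => ?_,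
      fun _ _ γ' τ' a ha _ _ γ'' τ'' => ?_⟩
    · simpa only [Sem.wk, Wk.comp_assoc] using h.2.1 _ _ (γ.comp γ') (τ.comp τ') a ha _ _ γ'' τ''
    · simpa only [Sem.wk, Wk.comp_assoc] using h.2.2 _ _ (γ.comp γ') (τ.comp τ') a ha _ _ γ'' τ''

end Rel

/-- Reification identifies related values and commutes with weakenings, and reflections are
related to themselves and commute with weakenings. -/
theorem reify_reflect_spec : ∀ T : Ty,
    (∀ {Ψ : GCtx} {Γ : Ctx} {a a' : Sem T Ψ Γ}, Rel T a a' → reify T a = reify T a') ∧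
    (∀ {Ψ Ψ' : GCtx} {Γ Γ' : Ctx} (γ : Wk Ψ' Ψ) (τ : Wk Γ' Γ) {a : Sem T Ψ Γ}, Rel T a a →
      (reify T a).wk γ τ = reify T (Sem.wk γ τ T a)) ∧
    (∀ {Ψ : GCtx} {Γ : Ctx} (v : Ne Ψ Γ T), Rel T (reflect T v) (reflect T v)) ∧
    (∀ {Ψ Ψ' : GCtx} {Γ Γ' : Ctx} (γ : Wk Ψ' Ψ) (τ : Wk Γ' Γ) (v : Ne Ψ Γ T),
      Sem.wk γ τ T (reflect T v) = reflect T (v.wk γ τ))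
  | .nat => by
    refine ⟨fun h => h, fun _ _ _ _ => rfl, fun _ => rfl, fun γ τ v => ?_⟩
    simp only [Sem.wk, reflect, Nf.wk]
    rfl
  | .box _ _ => by
    refine ⟨fun h => h, fun _ _ _ _ => rfl, fun _ => rfl, fun γ τ v => ?_⟩
    simp only [Sem.wk, reflect, Nf.wk]
    rfl
  | .arr S T => by
    obtain ⟨hS₁, hS₂, hS₃, hS₄⟩ := reify_reflect_spec S
    obtain ⟨hT₁, hT₂, hT₃, hT₄⟩ := reify_reflect_spec T
    -- Weakening passes through the reflection (`hT₄`) and through the reified argument (`hS₂`),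
    -- after which both sides are the same reflected neutral.
    have hnat : ∀ {Ψ : GCtx} {Γ : Ctx} (v : Ne Ψ Γ (.arr S T)) (Ψ' : GCtx) (Γ' : Ctx)
        (γ : Wk Ψ' Ψ) (τ : Wk Γ' Γ) (a : Sem S Ψ' Γ'), Rel S a a →
        ∀ (Ψ'' : GCtx) (Γ'' : Ctx) (γ' : Wk Ψ'' Ψ') (τ' : Wk Γ'' Γ'),
        Rel T (Sem.wk γ' τ' T (reflect (.arr S T) v Ψ' Γ' γ τ a))
          (reflect (.arr S T) v Ψ'' Γ'' (γ.comp γ') (τ.comp τ') (Sem.wk γ' τ' S a)) := by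
      intro Ψ Γ v Ψ' Γ' γ τ a ha Ψ'' Γ'' γ' τ'
      simp only [reflect, hT₄, Ne.wk, Ne.wk_wk, hS₂ γ' τ' ha]
      exact hT₃ _
    refine ⟨fun {Ψ Γ f f'} h => ?_, fun {Ψ Ψ' Γ Γ'} γ τ {f} h => ?_, fun v => ?_,
      fun γ τ v => ?_⟩
    · simp only [reify]
      exact congrArg _ (hT₁ (h.1 _ _ _ _ _ _ (hS₃ _)))
    · simp only [reify, Nf.wk]
      refine congrArg _ ((hT₂ _ _ (h.1 _ _ _ _ _ _ (hS₃ _))).trans (hT₁ ?_))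
      -- Naturality of `f` is used at the reflected fresh variable, along `γ` and `τ` kept under the
      -- binder. That weakening fixes the fresh variable, and both routes compose to `γ` and to `τ`
      -- followed by the drop.
      have := h.2.1 _ _ (Wk.id Ψ) (.drop S (Wk.id Γ)) _ (hS₃ (.var .z)) _ _ γ (.keep S τ)
      change Rel T _ (f _ _ (γ.comp (Wk.id _)) (τ.comp (.drop S (Wk.id _))) (reflect S (.var .z)))
      simpa only [hS₄, Ne.wk, Wk.comp, Wk.var, Wk.id_comp, Wk.comp_id] using this
    · refine ⟨fun _ _ γ τ a a' ha => ?_, hnat v, hnat v⟩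
      simp only [reflect, hS₁ ha]
      exact hT₃ _
    · funext Ψ₀ Γ₀ γ₀ τ₀ a
      simp only [reflect, Sem.wk, Ne.wk_wk]

section

variable {T : Ty} {Ψ Ψ' : GCtx} {Γ Γ' : Ctx}

theorem Rel.reify_eq {a a' : Sem T Ψ Γ} (h : Rel T a a') : reify T a = reify T a' :=
  (reify_reflect_spec T).1 h

theorem Rel.wk_reify {a : Sem T Ψ Γ} (h : Rel T a a) (γ : Wk Ψ' Ψ) (τ : Wk Γ' Γ) :
    (reify T a).wk γ τ = reify T (Sem.wk γ τ T a) :=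
  (reify_reflect_spec T).2.1 γ τ h

theorem Rel.reflect (v : Ne Ψ Γ T) : Rel T (reflect T v) (reflect T v) :=
  (reify_reflect_spec T).2.2.1 v

theorem wk_reflect (γ : Wk Ψ' Ψ) (τ : Wk Γ' Γ) (v : Ne Ψ Γ T) :
    Sem.wk γ τ T (reflect T v) = reflect T (v.wk γ τ) :=
  (reify_reflect_spec T).2.2.2 γ τ v

end

/-! ## Environments -/

/-- Pointwise related core environments. -/
def CEnv.Rel {Δ : CCtx} {Ψ : GCtx} {Γ : Ctx} (ρ ρ' : CEnv Δ Ψ Γ) : Prop :=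
  ∀ (A : CTy) (x : Var Δ A), Layered.Rel A.toTy (ρ A x) (ρ' A x)

/-- Pointwise related environments. -/
def Env.Rel {Δ : Ctx} {Ψ : GCtx} {Γ : Ctx} (ρ ρ' : Env Δ Ψ Γ) : Prop :=
  ∀ (A : Ty) (x : Var Δ A), Layered.Rel A (ρ A x) (ρ' A x)

namespace CEnv

variable {Δ : CCtx} {Ψ Ψ' Ψ'' : GCtx} {Γ Γ' Γ'' : Ctx}

theorem Rel.left {ρ ρ' : CEnv Δ Ψ Γ} (h : Rel ρ ρ') : Rel ρ ρ := fun A x => (h A x).left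

theorem Rel.cons {S : CTy} {ρ ρ' : CEnv Δ Ψ Γ} (h : Rel ρ ρ') {a a' : Sem S.toTy Ψ Γ}
    (ha : Layered.Rel S.toTy a a') : Rel (cons ρ a) (cons ρ' a')
  | _, .z => ha
  | _, .s x => h _ x

theorem Rel.wk (γ : Wk Ψ' Ψ) (τ : Wk Γ' Γ) {ρ ρ' : CEnv Δ Ψ Γ} (h : Rel ρ ρ') :
    Rel (CEnv.wk γ τ ρ) (CEnv.wk γ τ ρ') := fun A x => (h A x).wk γ τ

theorem wk_wk (γ : Wk Ψ' Ψ) (γ' : Wk Ψ'' Ψ') (τ : Wk Γ' Γ) (τ' : Wk Γ'' Γ') (ρ : CEnv Δ Ψ Γ) :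
    CEnv.wk γ' τ' (CEnv.wk γ τ ρ) = CEnv.wk (γ.comp γ') (τ.comp τ') ρ :=
  funext fun A => funext fun x => Sem.wk_wk _ _ _ _ _ (ρ A x)

theorem wk_cons {S : CTy} (γ : Wk Ψ' Ψ) (τ : Wk Γ' Γ) (ρ : CEnv Δ Ψ Γ) (a : Sem S.toTy Ψ Γ) :
    CEnv.wk γ τ (cons ρ a) = cons (CEnv.wk γ τ ρ) (Sem.wk γ τ S.toTy a) := by
  funext A x
  cases x <;> rfl

/-- Precomposition of a core environment with a weakening. -/
def comap {Δ' : CCtx} (τ : Wk Δ Δ') (ρ : CEnv Δ Ψ Γ) : CEnv Δ' Ψ Γ := fun _ x => ρ _ (τ.var x)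

@[simp] theorem comap_id (ρ : CEnv Δ Ψ Γ) : ρ.comap (Wk.id Δ) = ρ := by
  funext A x
  simp [comap]

theorem comap_cons {S : CTy} {Δ' : CCtx} (τ : Wk Δ Δ') (ρ : CEnv Δ Ψ Γ) (a : Sem S.toTy Ψ Γ) :
    (cons ρ a).comap (.keep S τ) = cons (ρ.comap τ) a := by
  funext A x
  cases x <;> rfl

theorem comap_drop {S : CTy} {Δ' : CCtx} (τ : Wk Δ Δ') (ρ : CEnv Δ Ψ Γ) (a : Sem S.toTy Ψ Γ) :
    (cons ρ a).comap (.drop S τ) = ρ.comap τ := by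
  funext A x
  simp [comap, Wk.var, cons]

end CEnv

namespace Env

variable {Δ : Ctx} {Ψ Ψ' Ψ'' : GCtx} {Γ Γ' Γ'' : Ctx}

theorem Rel.symm {ρ ρ' : Env Δ Ψ Γ} (h : Rel ρ ρ') : Rel ρ' ρ := fun A x => (h A x).symm

theorem Rel.left {ρ ρ' : Env Δ Ψ Γ} (h : Rel ρ ρ') : Rel ρ ρ := fun A x => (h A x).left

theorem Rel.right {ρ ρ' : Env Δ Ψ Γ} (h : Rel ρ ρ') : Rel ρ' ρ' := fun A x => (h A x).right

theorem Rel.cons {S : Ty} {ρ ρ' : Env Δ Ψ Γ} (h : Rel ρ ρ') {a a' : Sem S Ψ Γ}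
    (ha : Layered.Rel S a a') : Rel (cons ρ a) (cons ρ' a')
  | _, .z => ha
  | _, .s x => h _ x

theorem Rel.wk (γ : Wk Ψ' Ψ) (τ : Wk Γ' Γ) {ρ ρ' : Env Δ Ψ Γ} (h : Rel ρ ρ') :
    Rel (Env.wk γ τ ρ) (Env.wk γ τ ρ') := fun A x => (h A x).wk γ τ

theorem wk_id (ρ : Env Δ Ψ Γ) : Env.wk (Wk.id Ψ) (Wk.id Γ) ρ = ρ :=
  funext fun A => funext fun x => Sem.wk_id _ (ρ A x)

theorem wk_wk (γ : Wk Ψ' Ψ) (γ' : Wk Ψ'' Ψ') (τ : Wk Γ' Γ) (τ' : Wk Γ'' Γ') (ρ : Env Δ Ψ Γ) :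
    Env.wk γ' τ' (Env.wk γ τ ρ) = Env.wk (γ.comp γ') (τ.comp τ') ρ :=
  funext fun A => funext fun x => Sem.wk_wk _ _ _ _ _ (ρ A x)

theorem wk_cons {S : Ty} (γ : Wk Ψ' Ψ) (τ : Wk Γ' Γ) (ρ : Env Δ Ψ Γ) (a : Sem S Ψ Γ) :
    Env.wk γ τ (cons ρ a) = cons (Env.wk γ τ ρ) (Sem.wk γ τ S a) := by
  funext A x
  cases x <;> rfl

/-- Precomposition of an environment with a weakening. -/
def comap {Δ' : Ctx} (τ : Wk Δ Δ') (ρ : Env Δ Ψ Γ) : Env Δ' Ψ Γ := fun _ x => ρ _ (τ.var x)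

@[simp] theorem comap_id (ρ : Env Δ Ψ Γ) : ρ.comap (Wk.id Δ) = ρ := by
  funext A x
  simp [comap]

theorem wk_comap {Δ' : Ctx} (τ₀ : Wk Δ Δ') (γ : Wk Ψ' Ψ) (τ : Wk Γ' Γ) (ρ : Env Δ Ψ Γ) :
    Env.wk γ τ (ρ.comap τ₀) = (Env.wk γ τ ρ).comap τ₀ := rfl

theorem comap_cons {S : Ty} {Δ' : Ctx} (τ : Wk Δ Δ') (ρ : Env Δ Ψ Γ) (a : Sem S Ψ Γ) :
    (cons ρ a).comap (.keep S τ) = cons (ρ.comap τ) a := by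
  funext A x
  cases x <;> rfl

theorem comap_drop {S : Ty} {Δ' : Ctx} (τ : Wk Δ Δ') (ρ : Env Δ Ψ Γ) (a : Sem S Ψ Γ) :
    (cons ρ a).comap (.drop S τ) = ρ.comap τ := by
  funext A x
  simp [comap, Wk.var, cons]

theorem Rel.id (Ψ : GCtx) : ∀ Γ : Ctx, Rel (Env.id Ψ Γ) (Env.id Ψ Γ)
  | [] => fun _ x => nomatch x
  | _ :: Γ => ((Rel.id Ψ Γ).wk _ _).cons (.reflect _)

end Env

/-- Naturality of `f` pushes the weakening onto the argument; evaluating `f` at `γ; τ` is evaluating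
its weakening at the identity. This is the application case of naturality at both layers. -/
theorem Rel.app_wk {S T : Ty} {Ψ Ψ' : GCtx} {Γ Γ' : Ctx} {γ : Wk Ψ' Ψ} {τ : Wk Γ' Γ}
    {f : Sem (.arr S T) Ψ Γ} {f' : Sem (.arr S T) Ψ' Γ'} {a : Sem S Ψ Γ} {a' : Sem S Ψ' Γ'}
    (hf : Rel (.arr S T) f f) (ha : Rel S a a) (hf' : Rel (.arr S T) (Sem.wk γ τ _ f) f')
    (ha' : Rel S (Sem.wk γ τ _ a) a') :
    Rel T (Sem.wk γ τ T (f Ψ Γ (Wk.id Ψ) (Wk.id Γ) a)) (f' Ψ' Γ' (Wk.id Ψ') (Wk.id Γ') a') := by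
  refine (hf.2.1 _ _ _ _ _ ha _ _ γ τ).trans ?_
  simpa only [Sem.wk, Wk.id_comp, Wk.comp_id] using hf'.1 _ _ (Wk.id Ψ') (Wk.id Γ') _ _ ha'

/-! ## The interpretation of code -/

/-- Syntactic weakening merely reindexes the environment, so this is an equation and needs no
self-related `ρ`. -/
theorem interp0_wk {Φ Φ' : GCtx} (γ : Wk Φ' Φ) {Δ Δ' : CCtx} {T : CTy} (t : Exp0 Φ Δ T)
    (τ : Wk Δ' Δ) {Ψ : GCtx} {Γ : Ctx} (γ' : Wk Ψ Φ') (ρ : CEnv Δ' Ψ Γ) :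
    interp0 (t.wk γ τ) γ' ρ = interp0 t (γ.comp γ') (ρ.comap τ) := by
  induction t generalizing Δ' Ψ Γ with
  | var x => rfl
  | gvar u δ ih => simp only [Exp0.wk, interp0, ih, Wk.var_comp]
  | zero => rfl
  | succ t ih => exact congrArg Nf.succ (ih τ γ' ρ)
  | lam t ih =>
    funext Ψ' Γ' γ'' τ'' a
    simp only [Exp0.wk, interp0, ih, Wk.comp_assoc, CEnv.comap_cons]
    rfl
  | app t s iht ihs => simp only [Exp0.wk, interp0, iht, ihs]

/-- The two halves are one induction: for `lam`, being related includes naturality, which is the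
second half for the body; for `gvar`, commuting reification with weakening needs self-related
components, which is the first half. -/
theorem interp0_rel_and_wk {Φ : GCtx} {Δ : CCtx} {T : CTy} (t : Exp0 Φ Δ T) :
    (∀ {Ψ : GCtx} {Γ : Ctx} (γ : Wk Ψ Φ) {ρ ρ' : CEnv Δ Ψ Γ}, ρ.Rel ρ' →
      Rel T.toTy (interp0 t γ ρ) (interp0 t γ ρ')) ∧
    (∀ {Ψ Ψ' : GCtx} {Γ Γ' : Ctx} (γ : Wk Ψ Φ) (γ' : Wk Ψ' Ψ) (τ : Wk Γ' Γ) {ρ : CEnv Δ Ψ Γ},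
      ρ.Rel ρ → Rel T.toTy (Sem.wk γ' τ T.toTy (interp0 t γ ρ))
        (interp0 t (γ.comp γ') (CEnv.wk γ' τ ρ))) := by
  induction t with
  | var x => exact ⟨fun _ _ _ h => h _ x, fun _ γ' τ _ h => (h _ x).wk γ' τ⟩
  | gvar u δ ih =>
    refine ⟨fun γ ρ ρ' h => ?_, fun γ γ' τ ρ h => ?_⟩
    · simp only [interp0, fun A x => ((ih A x).1 γ h).reify_eq]
      exact .reflect _
    · simp only [interp0, wk_reflect, Ne.wk, Wk.var_comp,
        fun A x => ((ih A x).1 γ h).wk_reify γ' τ, fun A x => ((ih A x).2 γ γ' τ h).reify_eq]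
      exact .reflect _
  | zero => exact ⟨fun _ _ _ _ => rfl, fun _ _ _ _ _ => rfl⟩
  | succ t ih =>
    exact ⟨fun γ _ _ h => congrArg Nf.succ (ih.1 γ h),
      fun γ γ' τ _ h => congrArg Nf.succ (ih.2 γ γ' τ h)⟩
  | lam t ih =>
    have hwk : ∀ {Ψ : GCtx} {Γ : Ctx} (γ : Wk Ψ Φ) {ρ : CEnv _ Ψ Γ}, ρ.Rel ρ →
        ∀ (Ψ' : GCtx) (Γ' : Ctx) (γ' : Wk Ψ' Ψ) (τ' : Wk Γ' Γ) (a : Sem _ Ψ' Γ'), Rel _ a a →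
        ∀ (Ψ'' : GCtx) (Γ'' : Ctx) (γ'' : Wk Ψ'' Ψ') (τ'' : Wk Γ'' Γ'),
        Rel _ (Sem.wk γ'' τ'' _ (interp0 (.lam t) γ ρ Ψ' Γ' γ' τ' a))
          (interp0 (.lam t) γ ρ Ψ'' Γ'' (γ'.comp γ'') (τ'.comp τ'') (Sem.wk γ'' τ'' _ a)) := by
      intro Ψ Γ γ ρ h Ψ' Γ' γ' τ' a ha Ψ'' Γ'' γ'' τ''
      simpa only [interp0, Wk.comp_assoc, CEnv.wk_cons, CEnv.wk_wk] using
        ih.2 (γ.comp γ') γ'' τ'' ((h.wk γ' τ').cons ha)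
    have hrel : ∀ {Ψ : GCtx} {Γ : Ctx} (γ : Wk Ψ Φ) {ρ ρ' : CEnv _ Ψ Γ}, ρ.Rel ρ' → ρ'.Rel ρ' →
        Rel (.arr _ _) (interp0 (.lam t) γ ρ) (interp0 (.lam t) γ ρ') := fun γ ρ ρ' h h' =>
      ⟨fun _ _ γ' τ' a a' ha => ih.1 _ ((h.wk γ' τ').cons ha), hwk γ h.left, hwk γ h'⟩
    refine ⟨fun γ ρ ρ' h => hrel γ h fun A x => (h A x).right, fun γ γ' τ ρ h => ?_⟩
    refine Rel.arr ((hrel γ h h).wk γ' τ) (hrel _ (h.wk γ' τ) (h.wk γ' τ)) ?_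
    intro Ψ₀ Γ₀ γ₀ τ₀ a a' ha
    simp only [interp0, Sem.wk, Wk.comp_assoc, CEnv.wk_wk]
    exact ih.1 _ ((h.wk _ _).cons ha)
  | app t s iht ihs =>
    exact ⟨fun γ _ _ h => (iht.1 γ h).1 _ _ _ _ _ _ (ihs.1 γ h), fun γ γ' τ _ h =>
      Rel.app_wk (iht.1 γ h) (ihs.1 γ h) (iht.2 γ γ' τ h) (ihs.2 γ γ' τ h)⟩

theorem interp0_rel {Φ : GCtx} {Δ : CCtx} {T : CTy} (t : Exp0 Φ Δ T) {Ψ : GCtx} {Γ : Ctx}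
    (γ : Wk Ψ Φ) {ρ ρ' : CEnv Δ Ψ Γ} (h : ρ.Rel ρ') :
    Rel T.toTy (interp0 t γ ρ) (interp0 t γ ρ') :=
  (interp0_rel_and_wk t).1 γ h

theorem wk_interp0 {Φ : GCtx} {Δ : CCtx} {T : CTy} (t : Exp0 Φ Δ T) {Ψ Ψ' : GCtx} {Γ Γ' : Ctx}
    (γ : Wk Ψ Φ) (γ' : Wk Ψ' Ψ) (τ : Wk Γ' Γ) {ρ : CEnv Δ Ψ Γ} (h : ρ.Rel ρ) :
    Rel T.toTy (Sem.wk γ' τ T.toTy (interp0 t γ ρ)) (interp0 t (γ.comp γ') (CEnv.wk γ' τ ρ)) :=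
  (interp0_rel_and_wk t).2 γ γ' τ h

/-- Only a relation, not an equation: under a binder the components of `δ` are evaluated and then
weakened on one side, but evaluated in the weakened environment on the other, and these agree up to
`Rel` by `wk_interp0`. -/
theorem interp0_lsubst {Φ : GCtx} {Δ : CCtx} {T : CTy} (t : Exp0 Φ Δ T) {Δ' : CCtx}
    (δ : Sub0 Φ Δ' Δ) {Ψ : GCtx} {Γ : Ctx} (γ : Wk Ψ Φ) {ρ : CEnv Δ' Ψ Γ} (h : ρ.Rel ρ) :
    Rel T.toTy (interp0 (t.lsubst δ) γ ρ) (interp0 t γ (fun A x => interp0 (δ A x) γ ρ)) := by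
  induction t generalizing Δ' Ψ Γ with
  | var x => exact interp0_rel _ γ h
  | gvar u δ' ih =>
    simp only [Exp0.lsubst, interp0, fun A x => (ih A x δ γ h).reify_eq]
    exact .reflect _
  | zero => rfl
  | succ t ih => exact congrArg Nf.succ (ih δ γ h)
  | lam t ih =>
    refine Rel.arr (interp0_rel (.lam (t.lsubst (Sub0.lift _ δ))) γ h)
      (interp0_rel (.lam t) γ fun A x => interp0_rel (δ A x) γ h) ?_
    intro Ψ' Γ' γ' τ' a a' ha
    simp only [Exp0.lsubst, interp0]
    refine (ih _ _ ((h.wk γ' τ').cons ha.left)).trans (interp0_rel t _ ?_)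
    intro A x
    cases x with
    | z => exact ha
    | s x =>
      simp only [Sub0.lift, interp0_wk, Wk.id_comp, CEnv.comap_drop, CEnv.comap_id]
      exact (wk_interp0 (δ A x) γ γ' τ' h).symm
  | app t s iht ihs => exact (iht δ γ h).1 _ _ _ _ _ _ (ihs δ γ h)

/-! ## Case distinctions on code -/

section Branches

variable {Φ Φ' Ψ Ψ' : GCtx} {Δ Δ' Γ Γ' : Ctx} {Θ : CCtx} {T : CTy} {T' : Ty}

/-- The version with equations is needed for `interp1_wk`, where environments are arbitrary and
`Rel` is not available. -/
theorem letboxSem_congr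
    {b : ∀ (Ψ' : GCtx) (Γ' : Ctx), GSub Ψ' (⟨Θ, T⟩ :: Φ) → Env Δ Ψ' Γ' → Sem T' Ψ' Γ'}
    {b' : ∀ (Ψ' : GCtx) (Γ' : Ctx), GSub Ψ' (⟨Θ, T⟩ :: Φ') → Env Δ' Ψ' Γ' → Sem T' Ψ' Γ'}
    {σ : GSub Ψ Φ} {σ' : GSub Ψ Φ'} {ρ : Env Δ Ψ Γ} {ρ' : Env Δ' Ψ Γ}
    (hcons : ∀ c, b Ψ Γ (GSub.cons σ c) ρ = b' Ψ Γ (GSub.cons σ' c) ρ')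
    (hlift : b _ Γ (GSub.lift ⟨Θ, T⟩ σ) (Env.wk (.drop _ (Wk.id Ψ)) (Wk.id Γ) ρ) =
      b' _ Γ (GSub.lift _ σ') (Env.wk (.drop _ (Wk.id Ψ)) (Wk.id Γ) ρ')) :
    ∀ w, letboxSem b σ ρ w = letboxSem b' σ' ρ' w
  | .box c => hcons c
  | .ne v => congrArg (fun a => reflect T' (.letbox v (reify T' a))) hlift

theorem letboxSem_rel
    {b : ∀ (Ψ' : GCtx) (Γ' : Ctx), GSub Ψ' (⟨Θ, T⟩ :: Φ) → Env Δ Ψ' Γ' → Sem T' Ψ' Γ'}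
    {b' : ∀ (Ψ' : GCtx) (Γ' : Ctx), GSub Ψ' (⟨Θ, T⟩ :: Φ') → Env Δ' Ψ' Γ' → Sem T' Ψ' Γ'}
    {σ : GSub Ψ Φ} {σ' : GSub Ψ Φ'} {ρ : Env Δ Ψ Γ} {ρ' : Env Δ' Ψ Γ}
    (hcons : ∀ c, Rel T' (b Ψ Γ (GSub.cons σ c) ρ) (b' Ψ Γ (GSub.cons σ' c) ρ'))
    (hlift : Rel T' (b _ Γ (GSub.lift ⟨Θ, T⟩ σ) (Env.wk (.drop _ (Wk.id Ψ)) (Wk.id Γ) ρ))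
      (b' _ Γ (GSub.lift _ σ') (Env.wk (.drop _ (Wk.id Ψ)) (Wk.id Γ) ρ'))) :
    ∀ w, Rel T' (letboxSem b σ ρ w) (letboxSem b' σ' ρ' w)
  | .box c => hcons c
  | .ne v => by
    simp only [letboxSem, hlift.reify_eq]
    exact .reflect _

/-- For a neutral scrutinee the reified body must be weakened under the new global variable; `hlift`
is there because reification commutes with weakening only on self-related values. -/
theorem wk_letboxSem {γ : Wk Ψ' Ψ} {τ : Wk Γ' Γ}
    {b : ∀ (Ψ' : GCtx) (Γ' : Ctx), GSub Ψ' (⟨Θ, T⟩ :: Φ) → Env Δ Ψ' Γ' → Sem T' Ψ' Γ'}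
    {σ : GSub Ψ Φ} {ρ : Env Δ Ψ Γ}
    (hcons : ∀ c, Rel T' (Sem.wk γ τ T' (b Ψ Γ (GSub.cons σ c) ρ))
      (b Ψ' Γ' ((GSub.cons σ c).wk γ) (Env.wk γ τ ρ)))
    (hlift : Rel T' (b _ Γ (GSub.lift ⟨Θ, T⟩ σ) (Env.wk (.drop _ (Wk.id Ψ)) (Wk.id Γ) ρ))
      (b _ Γ (GSub.lift ⟨Θ, T⟩ σ) (Env.wk (.drop _ (Wk.id Ψ)) (Wk.id Γ) ρ)))
    (hlift' : Rel T'
      (Sem.wk (.keep _ γ) τ T' (b _ Γ (GSub.lift ⟨Θ, T⟩ σ)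
        (Env.wk (.drop _ (Wk.id Ψ)) (Wk.id Γ) ρ)))
      (b _ Γ' ((GSub.lift ⟨Θ, T⟩ σ).wk (.keep _ γ))
        (Env.wk (.keep _ γ) τ (Env.wk (.drop _ (Wk.id Ψ)) (Wk.id Γ) ρ)))) :
    ∀ w : Nf Ψ Γ (.box Θ T), Rel T' (Sem.wk γ τ T' (letboxSem b σ ρ w))
      (letboxSem b (σ.wk γ) (Env.wk γ τ ρ) (w.wk γ τ))
  | .box c => by
    have := hcons c
    rwa [GSub.wk_cons] at this
  | .ne v => by
    have e := hlift'.reify_eq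
    rw [GSub.wk_lift, Env.wk_wk, ← hlift.wk_reify] at e
    simp only [Wk.comp, Wk.id_comp] at e
    simp only [letboxSem, wk_reflect, Ne.wk, Nf.wk, e, Env.wk_wk, Wk.comp, Wk.comp_id]
    exact .reflect _

/-- The empty global substitution. -/
def GSub.nil (Ψ : GCtx) : GSub Ψ [] := fun _ _ u => nomatch u

/-- A body is only ever evaluated in two ways: with its pattern variables filled by some `ξ`
assembled from the subterms of the code, or by themselves when the match is stuck. Each `append` by
a concrete `ξ` unfolds to the extension made by `matchCode`. -/
theorem matchSem_congr {b : SemBranches Φ Δ Θ T T'} {b' : SemBranches Φ' Δ' Θ T T'}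
    {σ : GSub Ψ Φ} {σ' : GSub Ψ Φ'} {ρ : Env Δ Ψ Γ} {ρ' : Env Δ' Ψ Γ}
    (happend : ∀ p ξ, b p Ψ Γ (σ.append p.binds ξ) ρ = b' p Ψ Γ (σ'.append p.binds ξ) ρ')
    (hlifts : ∀ p, b p _ Γ (GSub.lifts σ p.binds) (Env.wk (Wk.drops Ψ p.binds) (Wk.id Γ) ρ) =
      b' p _ Γ (GSub.lifts σ' p.binds) (Env.wk (Wk.drops Ψ p.binds) (Wk.id Γ) ρ'))
    (w : Nf Ψ Γ (.box Θ T)) : matchSem b σ ρ w = matchSem b' σ' ρ' w := by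
  have h : nfbranch b σ ρ = nfbranch b' σ' ρ' := funext fun p => congrArg (reify T') (hlifts p)
  cases w with
  | ne v => simp only [matchSem, h]
  | box c =>
    cases c with
    | gvar u δ => simp only [matchSem, matchCode, h]
    | var x => exact happend (.var x) (.nil Ψ)
    | zero => exact happend .zero (.nil Ψ)
    | succ s => exact happend .succ (.cons (.nil Ψ) s)
    | lam s => exact happend .lam (.cons (.nil Ψ) s)
    | @app _ S _ t s => exact happend (.app S) (.cons (.cons (.nil Ψ) t) s)

theorem matchSem_rel {b : SemBranches Φ Δ Θ T T'} {b' : SemBranches Φ' Δ' Θ T T'}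
    {σ : GSub Ψ Φ} {σ' : GSub Ψ Φ'} {ρ : Env Δ Ψ Γ} {ρ' : Env Δ' Ψ Γ}
    (happend : ∀ p ξ,
      Rel T' (b p Ψ Γ (σ.append p.binds ξ) ρ) (b' p Ψ Γ (σ'.append p.binds ξ) ρ'))
    (hlifts : ∀ p, Rel T'
      (b p _ Γ (GSub.lifts σ p.binds) (Env.wk (Wk.drops Ψ p.binds) (Wk.id Γ) ρ))
      (b' p _ Γ (GSub.lifts σ' p.binds) (Env.wk (Wk.drops Ψ p.binds) (Wk.id Γ) ρ')))
    (w : Nf Ψ Γ (.box Θ T)) : Rel T' (matchSem b σ ρ w) (matchSem b' σ' ρ' w) := by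
  have h : nfbranch b σ ρ = nfbranch b' σ' ρ' := funext fun p => (hlifts p).reify_eq
  cases w with
  | ne v =>
    simp only [matchSem, h]
    exact .reflect _
  | box c =>
    cases c with
    | gvar u δ =>
      simp only [matchSem, matchCode, h]
      exact .reflect _
    | var x => exact happend (.var x) (.nil Ψ)
    | zero => exact happend .zero (.nil Ψ)
    | succ s => exact happend .succ (.cons (.nil Ψ) s)
    | lam s => exact happend .lam (.cons (.nil Ψ) s)
    | @app _ S _ t s => exact happend (.app S) (.cons (.cons (.nil Ψ) t) s)

theorem wk_matchSem {γ : Wk Ψ' Ψ} {τ : Wk Γ' Γ} {b : SemBranches Φ Δ Θ T T'}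
    {σ : GSub Ψ Φ} {ρ : Env Δ Ψ Γ}
    (happend : ∀ p ξ, Rel T' (Sem.wk γ τ T' (b p Ψ Γ (σ.append p.binds ξ) ρ))
      (b p Ψ' Γ' ((σ.append p.binds ξ).wk γ) (Env.wk γ τ ρ)))
    (hlifts : ∀ p, Rel T'
      (b p _ Γ (GSub.lifts σ p.binds) (Env.wk (Wk.drops Ψ p.binds) (Wk.id Γ) ρ))
      (b p _ Γ (GSub.lifts σ p.binds) (Env.wk (Wk.drops Ψ p.binds) (Wk.id Γ) ρ)))
    (hlifts' : ∀ p, Rel T'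
      (Sem.wk (γ.keeps p.binds) τ T' (b p _ Γ (GSub.lifts σ p.binds)
        (Env.wk (Wk.drops Ψ p.binds) (Wk.id Γ) ρ)))
      (b p _ Γ' ((GSub.lifts σ p.binds).wk (γ.keeps p.binds))
        (Env.wk (γ.keeps p.binds) τ (Env.wk (Wk.drops Ψ p.binds) (Wk.id Γ) ρ))))
    (w : Nf Ψ Γ (.box Θ T)) : Rel T' (Sem.wk γ τ T' (matchSem b σ ρ w))
      (matchSem b (σ.wk γ) (Env.wk γ τ ρ) (w.wk γ τ)) := by
  have h : ∀ p, (nfbranch b σ ρ p).wk (γ.keeps p.binds) τ =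
      nfbranch b (σ.wk γ) (Env.wk γ τ ρ) p := by
    intro p
    have e := (hlifts' p).reify_eq
    rw [GSub.wk_lifts, Env.wk_wk, ← (hlifts p).wk_reify] at e
    simpa only [nfbranch, Env.wk_wk, Wk.drops_comp_keeps, Wk.id_comp, Wk.comp_id] using e
  -- Weakening the extended substitution weakens `ξ` too, which matches the weakened subterms of the
  -- code.
  simp only [GSub.wk_append] at happend
  cases w with
  | ne v =>
    simp only [matchSem, wk_reflect, Ne.wk, Nf.wk, h]
    exact .reflect _
  | box c =>
    cases c with
    | gvar u δ =>
      simp only [matchSem, matchCode, wk_reflect, Ne.wk, Nf.wk, Exp0.wk, h]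
      exact .reflect _
    | var x =>
      simp only [Nf.wk, Exp0.wk, Wk.var_id]
      exact happend (.var x) (.nil Ψ)
    | zero => exact happend .zero (.nil Ψ)
    | succ s => exact happend .succ (.cons (.nil Ψ) s)
    | lam s => exact happend .lam (.cons (.nil Ψ) s)
    | @app _ S _ t s => exact happend (.app S) (.cons (.cons (.nil Ψ) t) s)

end Branches

/-! ## The interpretation of terms -/

theorem interp1_wk {Φ Φ' : GCtx} {Δ Δ' : Ctx} {T : Ty} (t : Exp1 Φ Δ T) (γ : Wk Φ' Φ)
    (τ : Wk Δ' Δ) {Ψ : GCtx} {Γ : Ctx} (σ : GSub Ψ Φ') (ρ : Env Δ' Ψ Γ) :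
    interp1 (t.wk γ τ) σ ρ = interp1 t (σ.comap γ) (ρ.comap τ) := by
  induction t generalizing Φ' Δ' Ψ Γ with
  | var x => rfl
  | gvar u δ ih => simp only [Exp1.wk, interp1, ih, GSub.comap]
  | zero => rfl
  | succ t ih => exact congrArg Nf.succ (ih γ τ σ ρ)
  | lam t ih =>
    funext Ψ' Γ' γ' τ' a
    simp only [Exp1.wk, interp1, ih, Env.comap_cons]
    rfl
  | app t s iht ihs => simp only [Exp1.wk, interp1, iht, ihs]
  | box t =>
    refine congrArg Nf.box ?_
    rw [Exp0.gsubst_wk, Exp0.wk_id]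
  | letbox s t ihs iht =>
    simp only [Exp1.wk, interp1, ihs]
    refine letboxSem_congr (fun c => ?_) ?_ _
    · rw [iht, GSub.comap_keep_cons]
    · rw [iht, GSub.comap_keep_lift, Env.wk_comap]
  | matchc s b ihs ihb =>
    simp only [Exp1.wk, interp1, ihs]
    refine matchSem_congr (fun p ξ => ?_) (fun p => ?_) _
    · rw [ihb, GSub.comap_keeps_append]
    · rw [ihb, GSub.comap_keeps_lifts, Env.wk_comap]

/-- As at layer 0, the two halves need each other. The global substitution is the same on both sides
of the first half, since code is compared only by equality. -/
theorem interp1_rel_and_wk {Φ : GCtx} {Δ : Ctx} {T : Ty} (t : Exp1 Φ Δ T) :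
    (∀ {Ψ : GCtx} {Γ : Ctx} (σ : GSub Ψ Φ) {ρ ρ' : Env Δ Ψ Γ}, ρ.Rel ρ' →
      Rel T (interp1 t σ ρ) (interp1 t σ ρ')) ∧
    (∀ {Ψ Ψ' : GCtx} {Γ Γ' : Ctx} (σ : GSub Ψ Φ) (γ : Wk Ψ' Ψ) (τ : Wk Γ' Γ) {ρ : Env Δ Ψ Γ},
      ρ.Rel ρ → Rel T (Sem.wk γ τ T (interp1 t σ ρ))
        (interp1 t (σ.wk γ) (Env.wk γ τ ρ))) := by
  induction t with
  | var x => exact ⟨fun _ _ _ h => h _ x, fun _ γ τ _ h => (h _ x).wk γ τ⟩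
  | gvar u δ ih =>
    refine ⟨fun σ ρ ρ' h => ?_, fun σ γ τ ρ h => ?_⟩
    · exact interp0_rel _ _ fun A x => (ih A x).1 σ h
    -- Code weakened by `γ` and evaluated at the identity is the original code evaluated at `γ`, so
    -- naturality at layer 0 applies.
    · simp only [interp1, GSub.wk, interp0_wk, CEnv.comap_id, Wk.comp_id]
      refine (wk_interp0 _ _ γ τ fun A x => (ih A x).1 σ h).trans ?_
      rw [Wk.id_comp]
      exact interp0_rel _ _ fun A x => (ih A x).2 σ γ τ h
  | zero => exact ⟨fun _ _ _ _ => rfl, fun _ _ _ _ _ => rfl⟩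
  | succ t ih =>
    exact ⟨fun σ _ _ h => congrArg Nf.succ (ih.1 σ h),
      fun σ γ τ _ h => congrArg Nf.succ (ih.2 σ γ τ h)⟩
  | @lam Φ Δ S T t ih =>
    have hwk : ∀ {Ψ : GCtx} {Γ : Ctx} (σ : GSub Ψ Φ) {ρ : Env Δ Ψ Γ}, ρ.Rel ρ →
        ∀ (Ψ' : GCtx) (Γ' : Ctx) (γ : Wk Ψ' Ψ) (τ : Wk Γ' Γ) (a : Sem S Ψ' Γ'), Rel S a a →
        ∀ (Ψ'' : GCtx) (Γ'' : Ctx) (γ' : Wk Ψ'' Ψ') (τ' : Wk Γ'' Γ'),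
        Rel T (Sem.wk γ' τ' T (interp1 (.lam t) σ ρ Ψ' Γ' γ τ a))
          (interp1 (.lam t) σ ρ Ψ'' Γ'' (γ.comp γ') (τ.comp τ') (Sem.wk γ' τ' S a)) := by
      intro Ψ Γ σ ρ h Ψ' Γ' γ τ a ha Ψ'' Γ'' γ' τ'
      simpa only [interp1, GSub.wk_wk, Env.wk_cons, Env.wk_wk] using
        ih.2 (σ.wk γ) γ' τ' ((h.wk γ τ).cons ha)
    have hrel : ∀ {Ψ : GCtx} {Γ : Ctx} (σ : GSub Ψ Φ) {ρ ρ' : Env Δ Ψ Γ}, ρ.Rel ρ' →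
        Rel (.arr S T) (interp1 (.lam t) σ ρ) (interp1 (.lam t) σ ρ') := fun σ ρ ρ' h =>
      ⟨fun _ _ γ τ a a' ha => ih.1 _ ((h.wk γ τ).cons ha), hwk σ h.left, hwk σ h.right⟩
    refine ⟨hrel, fun σ γ τ ρ h => ?_⟩
    refine Rel.arr ((hrel σ h).wk γ τ) (hrel _ (h.wk γ τ)) ?_
    intro Ψ₀ Γ₀ γ₀ τ₀ a a' ha
    simp only [interp1, Sem.wk, GSub.wk_wk, Env.wk_wk]
    exact ih.1 _ ((h.wk _ _).cons ha)
  | app t s iht ihs =>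
    exact ⟨fun σ _ _ h => (iht.1 σ h).1 _ _ _ _ _ _ (ihs.1 σ h), fun σ γ τ _ h =>
      Rel.app_wk (iht.1 σ h) (ihs.1 σ h) (iht.2 σ γ τ h) (ihs.2 σ γ τ h)⟩
  | box t =>
    refine ⟨fun _ _ _ _ => rfl, fun σ γ τ ρ _ => ?_⟩
    refine congrArg Nf.box ?_
    rw [Exp0.wk_gsubst, Exp0.wk_id]
  | letbox s t ihs iht =>
    refine ⟨fun σ ρ ρ' h => ?_, fun σ γ τ ρ h => ?_⟩
    -- `Rel` is equality at contextual types, so both scrutinees have the same value and the same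
    -- case is taken.
    · have e : interp1 s σ ρ = interp1 s σ ρ' := ihs.1 σ h
      simp only [interp1, e]
      exact letboxSem_rel (fun c => iht.1 _ h) (iht.1 _ (h.wk _ _)) _
    · have e : Nf.wk γ τ (interp1 s σ ρ) = interp1 s (σ.wk γ) (Env.wk γ τ ρ) := ihs.2 σ γ τ h
      simp only [interp1, ← e]
      exact wk_letboxSem (fun c => iht.2 _ γ τ h) (iht.1 _ (h.wk _ _)) (iht.2 _ _ _ (h.wk _ _)) _
  | matchc s b ihs ihb =>
    refine ⟨fun σ ρ ρ' h => ?_, fun σ γ τ ρ h => ?_⟩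
    · have e : interp1 s σ ρ = interp1 s σ ρ' := ihs.1 σ h
      simp only [interp1, e]
      exact matchSem_rel (fun p _ => (ihb p).1 _ h) (fun p => (ihb p).1 _ (h.wk _ _)) _
    · have e : Nf.wk γ τ (interp1 s σ ρ) = interp1 s (σ.wk γ) (Env.wk γ τ ρ) := ihs.2 σ γ τ h
      simp only [interp1, ← e]
      exact wk_matchSem (fun p _ => (ihb p).2 _ γ τ h) (fun p => (ihb p).1 _ (h.wk _ _))
        (fun p => (ihb p).2 _ _ _ (h.wk _ _)) _

theorem interp1_rel {Φ : GCtx} {Δ : Ctx} {T : Ty} (t : Exp1 Φ Δ T) {Ψ : GCtx} {Γ : Ctx}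
    (σ : GSub Ψ Φ) {ρ ρ' : Env Δ Ψ Γ} (h : ρ.Rel ρ') :
    Rel T (interp1 t σ ρ) (interp1 t σ ρ') :=
  (interp1_rel_and_wk t).1 σ h

theorem wk_interp1 {Φ : GCtx} {Δ : Ctx} {T : Ty} (t : Exp1 Φ Δ T) {Ψ Ψ' : GCtx} {Γ Γ' : Ctx}
    (σ : GSub Ψ Φ) (γ : Wk Ψ' Ψ) (τ : Wk Γ' Γ) {ρ : Env Δ Ψ Γ} (h : ρ.Rel ρ) :
    Rel T (Sem.wk γ τ T (interp1 t σ ρ)) (interp1 t (σ.wk γ) (Env.wk γ τ ρ)) :=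
  (interp1_rel_and_wk t).2 σ γ τ h

-- Semantic substitution lemmas at layer 1

/-- The interpretation of local substitutions. -/
def Sub1.interp {Φ Ψ : GCtx} {Δ Δ' Γ : Ctx} (δ : Sub1 Φ Δ' Δ) (σ : GSub Ψ Φ) (ρ : Env Δ' Ψ Γ) :
    Env Δ Ψ Γ := fun A x => interp1 (δ A x) σ ρ

section

variable {Φ Φ' Ψ Ψ' : GCtx} {Δ Δ' Δ'' Γ Γ' : Ctx}

theorem Sub1.interp_rel (δ : Sub1 Φ Δ' Δ) (σ : GSub Ψ Φ) {ρ ρ' : Env Δ' Ψ Γ} (h : ρ.Rel ρ') :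
    (δ.interp σ ρ).Rel (δ.interp σ ρ') := fun A x => interp1_rel (δ A x) σ h

theorem Sub1.wk_interp (δ : Sub1 Φ Δ' Δ) (σ : GSub Ψ Φ) (γ : Wk Ψ' Ψ) (τ : Wk Γ' Γ)
    {ρ : Env Δ' Ψ Γ} (h : ρ.Rel ρ) :
    (Env.wk γ τ (δ.interp σ ρ)).Rel (δ.interp (σ.wk γ) (Env.wk γ τ ρ)) :=
  fun A x => wk_interp1 (δ A x) σ γ τ h

theorem Sub1.interp_wk (δ : Sub1 Φ Δ' Δ) (γ : Wk Φ' Φ) (τ : Wk Δ'' Δ') (σ : GSub Ψ Φ')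
    (ρ : Env Δ'' Ψ Γ) : (δ.wk γ τ).interp σ ρ = δ.interp (σ.comap γ) (ρ.comap τ) :=
  funext fun A => funext fun x => interp1_wk (δ A x) γ τ σ ρ

theorem Sub1.interp_wk_append (δ : Sub1 Φ Δ' Δ) (σ : GSub Ψ Φ) (Ξ : GCtx) (ξ : GSub Ψ Ξ)
    (ρ : Env Δ' Ψ Γ) :
    (δ.wk (Wk.drops Φ Ξ) (Wk.id Δ')).interp (σ.append Ξ ξ) ρ = δ.interp σ ρ := by
  rw [interp_wk, GSub.comap_drops_append, Env.comap_id]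

theorem Sub1.interp_wk_lifts (δ : Sub1 Φ Δ' Δ) (σ : GSub Ψ Φ) (Ξ : GCtx) {ρ : Env Δ' Ψ Γ}
    (h : ρ.Rel ρ) :
    ((δ.wk (Wk.drops Φ Ξ) (Wk.id Δ')).interp (σ.lifts Ξ)
      (Env.wk (Wk.drops Ψ Ξ) (Wk.id Γ) ρ)).Rel
      (Env.wk (Wk.drops Ψ Ξ) (Wk.id Γ) (δ.interp σ ρ)) := by
  rw [interp_wk, GSub.comap_drops_lifts, Env.comap_id]
  exact (wk_interp δ σ _ _ h).symm

end

theorem interp1_lsubst {Φ : GCtx} {Δ Δ' : Ctx} {T : Ty} (t : Exp1 Φ Δ T) (δ : Sub1 Φ Δ' Δ)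
    {Ψ : GCtx} {Γ : Ctx} (σ : GSub Ψ Φ) {ρ : Env Δ' Ψ Γ} (h : ρ.Rel ρ) :
    Rel T (interp1 (t.lsubst δ) σ ρ) (interp1 t σ (δ.interp σ ρ)) := by
  induction t generalizing Δ' Ψ Γ with
  | var x => exact interp1_rel _ σ h
  | gvar u δ' ih => exact interp0_rel _ _ fun A x => ih A x δ σ h
  | zero => rfl
  | succ t ih => exact congrArg Nf.succ (ih δ σ h)
  | lam t ih =>
    refine Rel.arr (interp1_rel (.lam (t.lsubst (Sub1.lift _ δ))) σ h)
      (interp1_rel (.lam t) σ (δ.interp_rel σ h)) ?_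
    intro Ψ' Γ' γ τ a a' ha
    simp only [Exp1.lsubst, interp1]
    refine (ih _ _ ((h.wk γ τ).cons ha.left)).trans (interp1_rel t _ ?_)
    intro A x
    cases x with
    | z => exact ha
    | s x =>
      have e := interp1_wk (δ A x) (Wk.id _) (.drop _ (Wk.id _)) (σ.wk γ) ((Env.wk γ τ ρ).cons a)
      rw [GSub.comap_id, Env.comap_drop, Env.comap_id] at e
      exact (wk_interp1 (δ A x) σ γ τ h).symm.congr_left e
  | app t s iht ihs => exact (iht δ σ h).1 _ _ _ _ _ _ (ihs δ σ h)
  | box t => rfl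
  | @letbox Φ Δ Θ S T s t ihs iht =>
    have e : interp1 (s.lsubst δ) σ ρ = interp1 s σ (δ.interp σ ρ) := ihs δ σ h
    simp only [Exp1.lsubst, interp1, e]
    refine letboxSem_rel (fun c => ?_) ?_ _
    · refine (iht _ _ h).trans (.trans (interp1_rel t _ ?_) (interp1_rel t _ (δ.interp_rel σ h)))
      -- The binder of `letbox` is treated as a pattern context with one entry, filled by the code
      -- `c`.
      exact δ.interp_wk_append σ [⟨Θ, S⟩] (.cons (.nil Ψ) c) ρ ▸ δ.interp_rel σ h
    · exact (iht _ _ (h.wk _ _)).trans (interp1_rel t _ (δ.interp_wk_lifts σ [⟨Θ, S⟩] h))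
  | matchc s b ihs ihb =>
    have e : interp1 (s.lsubst δ) σ ρ = interp1 s σ (δ.interp σ ρ) := ihs δ σ h
    simp only [Exp1.lsubst, interp1, e]
    refine matchSem_rel (fun p ξ => ?_) (fun p => ?_) _
    · refine (ihb p _ _ h).trans ?_
      rw [δ.interp_wk_append]
      exact interp1_rel (b p) _ (δ.interp_rel σ h)
    · exact (ihb p _ _ (h.wk _ _)).trans (interp1_rel (b p) _ (δ.interp_wk_lifts σ _ h))

/-- This ties the layers together: code executed inside a program has the value that layer 0 assigns
to it. At a global variable `gsubst` creates a local substitution into `σ u`, which `interp0_lsubst`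
evaluates. -/
theorem interp1_run {Φ : GCtx} {Δ : CCtx} {Δ' : Ctx} {T : CTy} (t : Exp0 Φ Δ T)
    (δ : SubC Φ Δ' Δ) {Ψ : GCtx} {Γ : Ctx} (σ : GSub Ψ Φ) {ρ : Env Δ' Ψ Γ} (h : ρ.Rel ρ) :
    Rel T.toTy (interp1 (t.run δ) σ ρ)
      (interp0 (t.gsubst σ) (Wk.id Ψ) (fun A x => interp1 (δ A x) σ ρ)) := by
  induction t generalizing Δ' Ψ Γ with
  | var x => exact interp1_rel _ σ h
  | gvar u δ' ih =>
    have hδ : CEnv.Rel (fun A x => interp1 (δ A x) σ ρ) (fun A x => interp1 (δ A x) σ ρ) :=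
      fun A x => interp1_rel (δ A x) σ h
    exact (interp0_rel _ _ fun A x => ih A x δ σ h).trans (interp0_lsubst _ _ _ hδ).symm
  | zero => rfl
  | succ t ih => exact congrArg Nf.succ (ih δ σ h)
  | lam t ih =>
    refine Rel.arr (interp1_rel (.lam (t.run (SubC.lift _ δ))) σ h)
      (interp0_rel (.lam (t.gsubst σ)) (Wk.id Ψ) fun A x => interp1_rel (δ A x) σ h) ?_
    intro Ψ' Γ' γ τ a a' ha
    simp only [Exp0.run, Exp0.gsubst, interp0, interp1]
    refine (ih _ _ ((h.wk γ τ).cons ha.left)).trans ?_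
    -- Under the λ, layer 1 weakens the substitution `σ` while layer 0 keeps the code and records
    -- `γ` as its weakening; weakening the substituted code reconciles them.
    have e := Exp0.wk_gsubst γ σ (Wk.id _) t
    rw [Exp0.wk_id] at e
    rw [← e, interp0_wk, CEnv.comap_id, Wk.comp_id, Wk.id_comp]
    refine interp0_rel _ _ ?_
    intro A x
    cases x with
    | z => exact ha
    | s x =>
      have e := interp1_wk (δ A x) (Wk.id _) (.drop _ (Wk.id _)) (σ.wk γ) ((Env.wk γ τ ρ).cons a)
      rw [GSub.comap_id, Env.comap_drop, Env.comap_id] at e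
      exact (wk_interp1 (δ A x) σ γ τ h).symm.congr_left e
  | app t s iht ihs => exact (iht δ σ h).1 _ _ _ _ _ _ (ihs δ σ h)

/-- Composition of global substitutions is strict, also after `lift` and after instantiation of
pattern variables, so only the global variable case has content, and there `interp1_run` does the
work. -/
theorem interp1_gsubst {Φ Φ' : GCtx} {Δ : Ctx} {T : Ty} (t : Exp1 Φ Δ T) (σ' : GSub Φ' Φ)
    {Ψ : GCtx} {Γ : Ctx} (σ : GSub Ψ Φ') {ρ : Env Δ Ψ Γ} (h : ρ.Rel ρ) :
    Rel T (interp1 (t.gsubst σ') σ ρ) (interp1 t (σ'.comp σ) ρ) := by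
  induction t generalizing Φ' Ψ Γ with
  | var x => exact h _ x
  | gvar u δ ih => exact (interp1_run _ _ _ h).trans (interp0_rel _ _ fun A x => ih A x σ' σ h)
  | zero => rfl
  | succ t ih => exact congrArg Nf.succ (ih σ' σ h)
  | lam t ih =>
    refine Rel.arr (interp1_rel (.lam (t.gsubst σ')) σ h) (interp1_rel (.lam t) _ h) ?_
    intro Ψ' Γ' γ τ a a' ha
    simp only [Exp1.gsubst, interp1, ← GSub.comp_wk]
    exact (ih _ _ ((h.wk γ τ).cons ha.left)).trans (interp1_rel t _ ((h.wk γ τ).cons ha))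
  | app t s iht ihs => exact (iht σ' σ h).1 _ _ _ _ _ _ (ihs σ' σ h)
  | box t => exact congrArg Nf.box (Exp0.gsubst_gsubst _ _ t)
  | letbox s t ihs iht =>
    have e : interp1 (s.gsubst σ') σ ρ = interp1 s (σ'.comp σ) ρ := ihs σ' σ h
    simp only [Exp1.gsubst, interp1, e]
    refine letboxSem_rel (fun c => ?_) ?_ _
    · exact GSub.lift_comp_cons σ' σ c ▸ iht _ _ h
    · exact GSub.lift_comp_lift _ σ' σ ▸ iht _ _ (h.wk _ _)
  | matchc s b ihs ihb =>
    have e : interp1 (s.gsubst σ') σ ρ = interp1 s (σ'.comp σ) ρ := ihs σ' σ h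
    simp only [Exp1.gsubst, interp1, e]
    refine matchSem_rel (fun p ξ => ?_) (fun p => ?_) _
    · exact GSub.lifts_comp_append σ' σ _ ξ ▸ ihb p _ _ h
    · exact GSub.lifts_comp_lifts σ' σ _ ▸ ihb p _ _ (h.wk _ _)

/-- Evaluating `box s` yields `s[σ]`, so a redex evaluates its body in `σ, s[σ]/u`, which is the
composite of `id, s/u` with `σ`. Two environments are allowed so that the β cases follow directly.
-/
theorem interp1_gsubst_cons {Φ : GCtx} {Δ : Ctx} {Θ : CCtx} {S : CTy} {T : Ty}
    (t : Exp1 (⟨Θ, S⟩ :: Φ) Δ T) (s : Exp0 Φ Θ S) {Ψ : GCtx} {Γ : Ctx} (σ : GSub Ψ Φ)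
    {ρ ρ' : Env Δ Ψ Γ} (h : ρ.Rel ρ') :
    Rel T (interp1 t (GSub.cons σ (s.gsubst σ)) ρ)
      (interp1 (t.gsubst (GSub.cons (GSub.id Φ) s)) σ ρ') := by
  refine .trans ?_ (interp1_gsubst t _ σ h.right).symm
  rw [GSub.cons_comp, GSub.id_comp]
  exact interp1_rel t _ h

theorem interp1_gsubst_cons_cons {Φ : GCtx} {Δ : Ctx} {Θ Θ' : CCtx} {S S' : CTy} {T : Ty}
    (t : Exp1 (⟨Θ, S⟩ :: ⟨Θ', S'⟩ :: Φ) Δ T) (s' : Exp0 Φ Θ' S') (s : Exp0 Φ Θ S) {Ψ : GCtx}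
    {Γ : Ctx} (σ : GSub Ψ Φ) {ρ ρ' : Env Δ Ψ Γ} (h : ρ.Rel ρ') :
    Rel T (interp1 t (GSub.cons (GSub.cons σ (s'.gsubst σ)) (s.gsubst σ)) ρ)
      (interp1 (t.gsubst (GSub.cons (GSub.cons (GSub.id Φ) s') s)) σ ρ') := by
  refine .trans ?_ (interp1_gsubst t _ σ h.right).symm
  rw [GSub.cons_comp, GSub.cons_comp, GSub.id_comp]
  exact interp1_rel t _ h

/-! ## Completeness -/

/-- Layer 0 has only congruence, symmetry and transitivity, so nothing but identical code is
identified; intensional analysis by `match` depends on this. -/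
theorem Eqv0.eq {Ψ : GCtx} {Γ : CCtx} {T : CTy} {t t' : Exp0 Ψ Γ T} (h : Eqv0 t t') : t = t' := by
  induction h with
  | symm _ ih => exact ih.symm
  | trans _ _ ih ih' => exact ih.trans ih'
  | gvar u _ ih => exact congrArg _ (funext fun A => funext fun x => ih A x)
  | var | zero => rfl
  | _ => simp_all

/-- The environments must be allowed to differ because the congruence rule for `lam` extends them by
related but distinct arguments. -/
theorem Eqv1.interp1_rel {Φ : GCtx} {Δ : Ctx} {T : Ty} {t t' : Exp1 Φ Δ T} (h : Eqv1 t t')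
    {Ψ : GCtx} {Γ : Ctx} (σ : GSub Ψ Φ) {ρ ρ' : Env Δ Ψ Γ} (hρ : ρ.Rel ρ') :
    Rel T (interp1 t σ ρ) (interp1 t' σ ρ') := by
  induction h generalizing Ψ Γ with
  | symm _ ih => exact (ih σ hρ.symm).symm
  | trans _ _ ih ih' => exact (ih σ hρ.left).trans (ih' σ hρ)
  | var x => exact hρ _ x
  | gvar u _ ih => exact interp0_rel _ _ fun A x => ih A x σ hρ
  | zero => rfl
  | succ _ ih => exact congrArg Nf.succ (ih σ hρ)
  | @lam _ _ _ _ t t' _ ih =>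
    exact Rel.arr (Layered.interp1_rel (.lam t) σ hρ.left) (Layered.interp1_rel (.lam t') σ hρ.right)
      fun _ _ γ τ _ _ ha => ih _ ((hρ.wk γ τ).cons ha)
  | app _ _ iht ihs => exact (iht σ hρ).1 _ _ _ _ _ _ (ihs σ hρ)
  | box h => exact congrArg (fun t => Nf.box (t.gsubst σ)) h.eq
  | @letbox _ _ _ _ _ s s' _ _ _ _ ihs iht =>
    have e : interp1 s σ ρ = interp1 s' σ ρ' := ihs σ hρ
    simp only [interp1, e]
    exact letboxSem_rel (fun c => iht _ hρ) (iht _ (hρ.wk _ _)) _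
  | @matchc _ _ _ _ _ s s' _ _ _ _ ihs ihb =>
    have e : interp1 s σ ρ = interp1 s' σ ρ' := ihs σ hρ
    simp only [interp1, e]
    exact matchSem_rel (fun p _ => ihb p _ hρ) (fun p => ihb p _ (hρ.wk _ _)) _
  | beta_lam t s =>
    refine .trans ?_ (interp1_lsubst t _ σ hρ.right).symm
    -- The semantic function is applied at the identity weakening, which leaves `σ` and the
    -- environment unchanged.
    simp only [interp1, GSub.wk_id, Env.wk_id]
    refine Layered.interp1_rel t σ ?_
    intro A x
    cases x with
    | z => exact Layered.interp1_rel s σ hρ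
    | s x => exact hρ _ x
  | beta_letbox s t => exact interp1_gsubst_cons t s σ hρ
  | beta_match_var x b => exact Layered.interp1_rel (b (.var x)) σ hρ
  | beta_match_zero b => exact Layered.interp1_rel (b .zero) σ hρ
  | beta_match_succ s b => exact interp1_gsubst_cons (b .succ) s σ hρ
  | beta_match_lam s b => exact interp1_gsubst_cons (b .lam) s σ hρ
  | @beta_match_app _ _ _ S _ _ t s b => exact interp1_gsubst_cons_cons (b (.app S)) t s σ hρ
  | @eta _ _ S T t =>
    refine Rel.arr (Layered.interp1_rel t σ hρ.left)
      (Layered.interp1_rel (.lam (.app (t.wk _ _) (.var .z))) σ hρ.right) ?_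
    intro Ψ' Γ' γ τ a a' ha
    simp only [interp1, interp1_wk, GSub.comap_id, Env.comap_drop, Env.comap_id]
    -- The expansion evaluates `t` after weakening and applies it at the identity; naturality of the
    -- interpretation turns this into the value of `t` applied at `γ; τ`.
    have := ((wk_interp1 t σ γ τ hρ.left).trans
      (Layered.interp1_rel t (σ.wk γ) (hρ.wk γ τ))).1 _ _ (Wk.id Ψ') (Wk.id Γ') _ _ ha
    simp only [Sem.wk, Wk.comp_id] at this
    exact this

end Layered

theorem mainTheorem2 {Ψ : Layered.GCtx} {Γ : Layered.Ctx} {T : Layered.Ty}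
    (t t' : Layered.Exp1 Ψ Γ T) (h : Layered.Eqv1 t t') :
    Layered.nbe t = Layered.nbe t' :=
  (h.interp1_rel (Layered.GSub.id Ψ) (Layered.Env.Rel.id Ψ Γ)).reify_eq
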